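/- Let $n\ge 2$, $J=\mathrm{diag}(1,\dots,1,-1)\in M_{n+1}(\mathbb R)$, and let $G=\mathrm{SO}(n,1)^\circ$ be the identity component of $\{A\in GL_{n+1}(\mathbb R): A^{T}JA=J,\ \det A=1\}$, with Lie algebra $\mathfrak g=\{X: X^{T}J+JX=0,\ \operatorname{tr}X=0\}$ and Cartan involution $\theta X=-X^{T}$. Put $\mathfrak k=\{\theta X=X\}$, $\mathfrak p=\{\theta X=-X\}$, $\mathrm a_1=E_{1,n+1}+E_{n+1,1}$, $\mathfrak m=\{X\in\mathfrak k:[\mathrm a_1,X]=0\}$, $\mathfrak n=\{X\in\mathfrak g:[\mathrm a_1,X]=X\}$ (of dimension $n-1$), $K=\{g\in G: g^{T}g=1\}\cong \mathrm{SO}(n)$, $A=\exp(\mathbb R\mathrm a_1)$, $N=\exp\mathfrak n$. Let $\langle X,Y\rangle=\frac1{2(n-1)}\operatorname{tr}(\operatorname{ad}X\operatorname{ad}Y)$; orthonormality in $\mathfrak g$ refers to the inner product $-\langle X,\theta Y\rangle$. Let $\Omega=-\sum_i K_i^2+\sum_j P_j^2\in U(\mathfrak g)$ for any orthonormal bases $(K_i)$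 of $\mathfrak k$ and $(P_j)$ of $\mathfrak p$, let $\Omega_M=-\sum_j m_j^2\in U(\mathfrak m)$ for any orthonormal basis $(m_j)$ of $\mathfrak m$, let $(n_i)_{1\le i\le n-1}$ be any orthonormal basis of $\mathfrak n$, and let $k_i=\frac1{\sqrt2}(n_i+\theta n_i)\in\mathfrak k$. For $y\in\mathfrak g$ and $f\in C^\infty(G)$ (complex-valued) let $\mathfrak L_yf(g)=\frac{d}{ds}f(\exp(sy)g)|_{s=0}$, extended to $U(\mathfrak g)$ as an algebra anti-homomorphism. Every $g\in G$ can be written uniquely as $g=ka\nu$ with $k\in K$, $a=\exp(t\,\mathrm a_1)$, $t\in\mathbb R$, $\nu\in N$. Define, for functions $f$ on $G$ and at $g=ka\nu$, $$\mathfrak K_xf(g)=\tfrac{d}{ds}f(k\exp(sx)a\nu)|_{s=0}\ (x\in\mathfrak k),\quad \mathfrak A_{\mathrm a_1}f(g)=\tfrac{d}{ds}f(k\exp(s\mathrm a_1)a\nu)|_{s=0},\quad \mathfrak N_xf(g)=\tfrac{d}{ds}f(ka\exp(sx)\nu)|_{s=0}\ (x\in\mathfrak n),$$ and let $\mathfrak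 K_u$, for $u\in U(\mathfrak k)$, be the multiplicative extension of $x\mapsto\mathfrak K_x$, i.e. $\mathfrak K_uf(ka\nu)$ is the value at $k$ of the function obtained by letting $u$ act on $h\mapsto f(ha\nu)$ through the derived right action $\mathfrak R_yF(h)=\frac{d}{ds}F(h\exp(sy))|_{s=0}$; let $\mathfrak K_{\Omega_M}$ be the operator so attached to the image of $\Omega_M$ in $U(\mathfrak k)$. Then for every $f\in C^\infty(G)$ and every $g=k\exp(t\,\mathrm a_1)\nu\in G$, $$\mathfrak L_\Omega f(g)=\mathfrak A_{\mathrm a_1}^2f(g)+(n-1)\mathfrak A_{\mathrm a_1}f(g)+2e^{-t}\sum_{i=1}^{n-1}\Bigl[-\sqrt2\,\mathfrak K_{k_i}\mathfrak N_{n_i}f(g)+e^{-t}\,\mathfrak N_{n_i}^2f(g)\Bigr]+\mathfrak K_{\Omega_M}f(g).$$ -/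

import Mathlib

open scoped Matrix ContDiff Topology

attribute [local instance] LieRing.ofAssociativeRing

namespace LorentzCasimir

/-! ### The group `SO(n,1)°` and its Lie algebra -/

/-- Real `(n+1) × (n+1)` matrices; the indices `0, …, n-1` are the space-like directions and
`Fin.last n` is the time-like one. -/
abbrev Mat (n : ℕ) : Type := Matrix (Fin (n + 1)) (Fin (n + 1)) ℝ

/-- `J = diag(1, …, 1, -1)`. -/
def J (n : ℕ) : Mat n := Matrix.diagonal fun i => if i = Fin.last n then -1 else 1

/-- The group `{A ∈ GL_{n+1}(ℝ) | Aᵀ J A = J, det A = 1}`. -/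
def fullGroup (n : ℕ) : Subgroup (GL (Fin (n + 1)) ℝ) where
  carrier := {A | (A : Mat n)ᵀ * J n * (A : Mat n) = J n ∧ (A : Mat n).det = 1}
  one_mem' := by simp
  mul_mem' := by
    rintro A B ⟨hA, hA'⟩ ⟨hB, hB'⟩
    refine ⟨?_, by simp [hA', hB']⟩
    calc ((A * B : GL (Fin (n + 1)) ℝ) : Mat n)ᵀ * J n * ((A * B : GL (Fin (n + 1)) ℝ) : Mat n)
        = (B : Mat n)ᵀ * ((A : Mat n)ᵀ * J n * (A : Mat n)) * (B : Mat n) := by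
          simp [Matrix.mul_assoc]
      _ = J n := by rw [hA, hB]
  inv_mem' := by
    rintro A ⟨hA, hA'⟩
    have h1 : (A : Mat n) * ((A⁻¹ : GL (Fin (n + 1)) ℝ) : Mat n) = 1 := by
      rw [← Units.val_mul]; simp
    have h2 : ((A⁻¹ : GL (Fin (n + 1)) ℝ) : Mat n)ᵀ * (A : Mat n)ᵀ = 1 := by
      rw [← Matrix.transpose_mul, h1, Matrix.transpose_one]
    refine ⟨?_, ?_⟩
    · calc ((A⁻¹ : GL (Fin (n + 1)) ℝ) : Mat n)ᵀ * J n * ((A⁻¹ : GL (Fin (n + 1)) ℝ) : Mat n)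
          = ((A⁻¹ : GL (Fin (n + 1)) ℝ) : Mat n)ᵀ * ((A : Mat n)ᵀ * J n * (A : Mat n))
              * ((A⁻¹ : GL (Fin (n + 1)) ℝ) : Mat n) := by rw [hA]
        _ = (((A⁻¹ : GL (Fin (n + 1)) ℝ) : Mat n)ᵀ * (A : Mat n)ᵀ) * J n
              * ((A : Mat n) * ((A⁻¹ : GL (Fin (n + 1)) ℝ) : Mat n)) := by
            simp only [Matrix.mul_assoc]
        _ = J n := by rw [h1, h2]; simp
    · have := congrArg Matrix.det h1
      rw [Matrix.det_mul, hA', Matrix.det_one, one_mul] at this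
      exact this

/-- `G = SO(n,1)°`: the identity component of `fullGroup n`, as a subgroup of `GL_{n+1}(ℝ)`. -/
def G (n : ℕ) : Subgroup (GL (Fin (n + 1)) ℝ) :=
  (Subgroup.connectedComponentOfOne (fullGroup n)).map (fullGroup n).subtype

/-- The matrix of an element of `G`. -/
def mat {n : ℕ} (g : G n) : Mat n := ((g : GL (Fin (n + 1)) ℝ) : Mat n)

/-- The space `ℝ^((n+1) × (n+1))` of matrix entries, as a normed space. -/
abbrev Entries (n : ℕ) : Type := Fin (n + 1) → Fin (n + 1) → ℝ

/-- The matrix entries of an element of `G`. -/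
def ent {n : ℕ} (g : G n) : Entries n := fun i j => mat g i j

/-- The Lie algebra `𝔤 = 𝔰𝔬(n,1) = {X | Xᵀ J + J X = 0, tr X = 0}`. -/
def so (n : ℕ) : LieSubalgebra ℝ (Mat n) where
  carrier := {X | Xᵀ * J n + J n * X = 0 ∧ X.trace = 0}
  zero_mem' := by simp
  add_mem' := by
    rintro X Y ⟨hX, hX'⟩ ⟨hY, hY'⟩
    refine ⟨?_, by simp [hX', hY']⟩
    calc (X + Y)ᵀ * J n + J n * (X + Y) = (Xᵀ * J n + J n * X) + (Yᵀ * J n + J n * Y) := by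
          rw [Matrix.transpose_add]; noncomm_ring
      _ = 0 := by rw [hX, hY, add_zero]
  smul_mem' := by
    rintro c X ⟨hX, hX'⟩
    refine ⟨?_, by simp [hX']⟩
    calc (c • X)ᵀ * J n + J n * (c • X) = c • (Xᵀ * J n + J n * X) := by
          simp [Matrix.transpose_smul, smul_add]
      _ = 0 := by rw [hX, smul_zero]
  lie_mem' := by
    rintro X Y ⟨hX, -⟩ ⟨hY, -⟩
    have hX2 : Xᵀ * J n = -(J n * X) := eq_neg_of_add_eq_zero_left hX
    have hY2 : Yᵀ * J n = -(J n * Y) := eq_neg_of_add_eq_zero_left hY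
    refine ⟨?_, ?_⟩
    · rw [LieRing.of_associative_ring_bracket, Matrix.transpose_sub, Matrix.transpose_mul,
        Matrix.transpose_mul, sub_mul, Matrix.mul_assoc, Matrix.mul_assoc, hX2, hY2, mul_neg,
        mul_neg, ← Matrix.mul_assoc, ← Matrix.mul_assoc, hX2, hY2]
      noncomm_ring
    · rw [LieRing.of_associative_ring_bracket, Matrix.trace_sub, Matrix.trace_mul_comm, sub_self]

/-- The Cartan involution `θ X = -Xᵀ` of `𝔤`. -/
def theta (n : ℕ) : so n →ₗ[ℝ] so n where
  toFun X := ⟨-(X : Mat n)ᵀ, by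
    obtain ⟨hX, hX'⟩ := X.2
    have hJ : J n * J n = 1 := by
      simp only [J, Matrix.diagonal_mul_diagonal]
      rw [← Matrix.diagonal_one]
      congr 1
      funext i
      split_ifs <;> simp
    refine ⟨?_, by simp [hX']⟩
    have h2 : (X : Mat n)ᵀ = -(J n * X * J n) := by
      have h := congrArg (· * J n) hX
      simp only [add_mul, Matrix.mul_assoc, hJ, Matrix.mul_one, zero_mul] at h
      rw [Matrix.mul_assoc]
      exact eq_neg_of_add_eq_zero_left h
    rw [Matrix.transpose_neg, Matrix.transpose_transpose, h2, neg_neg]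
    calc -(X : Mat n) * J n + J n * (J n * X * J n)
        = -(X : Mat n) * J n + (J n * J n) * (X * J n) := by simp only [Matrix.mul_assoc]
      _ = 0 := by rw [hJ]; simp⟩
  map_add' X Y := by
    ext1
    change -((X : Mat n) + (Y : Mat n))ᵀ = -(X : Mat n)ᵀ + -(Y : Mat n)ᵀ
    rw [Matrix.transpose_add, neg_add]
  map_smul' c X := by
    ext1
    change -(c • (X : Mat n))ᵀ = c • -(X : Mat n)ᵀ
    rw [Matrix.transpose_smul, smul_neg]

theorem theta_theta {n : ℕ} (X : so n) : theta n (theta n X) = X := by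
  ext1; simp [theta]

theorem theta_lie {n : ℕ} (X Y : so n) : theta n ⁅X, Y⁆ = ⁅theta n X, theta n Y⁆ := by
  ext1
  simp only [theta, LinearMap.coe_mk, AddHom.coe_mk, LieSubalgebra.coe_bracket,
    LieRing.of_associative_ring_bracket, Matrix.transpose_sub, Matrix.transpose_mul]
  noncomm_ring

/-- The rescaled Killing form `⟨X, Y⟩ = B(X, Y) / (2 (n - 1))` on `𝔤`. -/
noncomputable def form (n : ℕ) (X Y : so n) : ℝ :=
  killingForm ℝ (so n) X Y / (2 * ((n : ℝ) - 1))

/-- The inner product `-⟨X, θ Y⟩` attached to the rescaled Killing form; orthonormality of vectors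
of `𝔤` refers to it. It is `-⟨X, Y⟩` on `𝔨` and `⟨X, Y⟩` on `𝔭`. -/
noncomputable def innerProd (n : ℕ) (X Y : so n) : ℝ := -form n X (theta n Y)

/-- A family of vectors of `𝔤` is orthonormal. -/
def IsOrthonormal {n : ℕ} {ι : Type*} (b : ι → so n) : Prop :=
  (∀ i, innerProd n (b i) (b i) = 1) ∧ ∀ i j, i ≠ j → innerProd n (b i) (b j) = 0

/-- `𝔨 = {X ∈ 𝔤 | θ X = X}`. -/
def kAlg (n : ℕ) : LieSubalgebra ℝ (so n) where
  carrier := {X | theta n X = X}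
  zero_mem' := by simp
  add_mem' := by intro X Y hX hY; simp_all
  smul_mem' := by intro c X hX; simp_all
  lie_mem' := by intro X Y hX hY; simp_all [theta_lie]

/-- `𝔭 = {X ∈ 𝔤 | θ X = -X}`. -/
def pSub (n : ℕ) : Submodule ℝ (so n) where
  carrier := {X | theta n X = -X}
  zero_mem' := by simp
  add_mem' := by intro X Y hX hY; simp_all [add_comm]
  smul_mem' := by intro c X hX; simp_all

/-- The vector `a₁` with entries `1` in the positions (first, last) and (last, first), and `0`
elsewhere. -/
def a₁ (n : ℕ) [NeZero n] : so n :=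
  ⟨Matrix.single 0 (Fin.last n) 1 + Matrix.single (Fin.last n) 0 1, by
    have h : (0 : Fin (n + 1)) ≠ Fin.last n := by
      intro h
      exact NeZero.ne n (by simpa [Fin.ext_iff] using h.symm)
    refine ⟨?_, ?_⟩
    · ext i j
      simp [J, Matrix.single_apply, Matrix.add_mul, Matrix.mul_add]
      by_cases hi : i = Fin.last n <;> by_cases hj : j = Fin.last n <;>
        by_cases hi0 : i = 0 <;> by_cases hj0 : j = 0 <;> simp_all [eq_comm]
    · rw [Matrix.trace_add, Matrix.trace_single_eq_of_ne _ _ _ h,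
        Matrix.trace_single_eq_of_ne _ _ _ h.symm, add_zero]⟩

/-- `𝔪`: the centralizer of `𝔞 = ℝ a₁` in `𝔨`; it is the Lie algebra of `M = Z_K(A)`. -/
def mAlg (n : ℕ) [NeZero n] : LieSubalgebra ℝ (so n) where
  carrier := {X | X ∈ kAlg n ∧ ⁅a₁ n, X⁆ = 0}
  zero_mem' := by simp
  add_mem' := by
    rintro X Y ⟨hX, hX'⟩ ⟨hY, hY'⟩
    exact ⟨add_mem hX hY, by rw [lie_add, hX', hY', add_zero]⟩
  smul_mem' := by
    rintro c X ⟨hX, hX'⟩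
    exact ⟨(kAlg n).smul_mem c hX, by rw [lie_smul, hX', smul_zero]⟩
  lie_mem' := by
    rintro X Y ⟨hX, hX'⟩ ⟨hY, hY'⟩
    exact ⟨(kAlg n).lie_mem hX hY, by rw [leibniz_lie, hX', hY']; simp⟩

/-- `𝔫 = 𝔤_α = {X ∈ 𝔤 | [a₁, X] = X}`. -/
def nSub (n : ℕ) [NeZero n] : Submodule ℝ (so n) where
  carrier := {X | ⁅a₁ n, X⁆ = X}
  zero_mem' := by simp
  add_mem' := by intro X Y hX hY; simp_all
  smul_mem' := by intro c X hX; simp_all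

/-- For `X ∈ 𝔫`, the vector `(X + θ X) / √2` of `𝔨`. -/
noncomputable def kVec {n : ℕ} [NeZero n] (X : nSub n) : kAlg n :=
  ⟨(Real.sqrt 2)⁻¹ • ((X : so n) + theta n X), by
    change theta n _ = _
    rw [map_smul, map_add, theta_theta, add_comm (theta n (X : so n))]⟩

/-! ### The exponential map -/

section Exp

attribute [local instance] Matrix.linftyOpNormedAddCommGroup Matrix.linftyOpNormedSpace
  Matrix.linftyOpNormedRing Matrix.linftyOpNormedAlgebra

/-- The matrix exponential as an invertible matrix. -/
noncomputable def expGL {n : ℕ} (X : Mat n) : GL (Fin (n + 1)) ℝ where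
  val := NormedSpace.exp X
  inv := NormedSpace.exp (-X)
  val_inv := by
    rw [← Matrix.exp_add_of_commute _ _ (Commute.neg_right (Commute.refl X))]; simp
  inv_val := by
    rw [← Matrix.exp_add_of_commute _ _ (Commute.neg_left (Commute.refl X))]; simp

theorem expGL_mem {n : ℕ} (X : so n) : expGL (X : Mat n) ∈ fullGroup n := by
  have key : ∀ Y : so n, (NormedSpace.exp (Y : Mat n))ᵀ * J n * NormedSpace.exp (Y : Mat n)
      = J n := by
    intro Y
    have hJ : J n * J n = 1 := by
      simp only [J, Matrix.diagonal_mul_diagonal]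
      rw [← Matrix.diagonal_one]
      congr 1
      funext i
      split_ifs <;> simp
    let U : (Mat n)ˣ := ⟨J n, J n, hJ, hJ⟩
    have hY : (Y : Mat n)ᵀ = (U : Mat n) * (-(Y : Mat n)) * ((U⁻¹ : (Mat n)ˣ) : Mat n) := by
      have h := congrArg (· * J n) Y.2.1
      simp only [add_mul, Matrix.mul_assoc, hJ, Matrix.mul_one, zero_mul] at h
      change (Y : Mat n)ᵀ = J n * (-(Y : Mat n)) * J n
      rw [mul_neg, neg_mul, Matrix.mul_assoc]
      exact eq_neg_of_add_eq_zero_left h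
    rw [← Matrix.exp_transpose, hY, Matrix.exp_units_conj]
    change J n * NormedSpace.exp (-(Y : Mat n)) * J n * J n * NormedSpace.exp (Y : Mat n) = J n
    rw [Matrix.mul_assoc _ (J n) (J n), hJ, Matrix.mul_one, Matrix.mul_assoc,
      ← Matrix.exp_add_of_commute _ _ (Commute.neg_left (Commute.refl (Y : Mat n)))]
    simp
  refine ⟨key X, ?_⟩
  change (NormedSpace.exp (X : Mat n)).det = 1
  have h2 : NormedSpace.exp (X : Mat n)
      = NormedSpace.exp (((2 : ℝ)⁻¹ • X : so n) : Mat n)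
        * NormedSpace.exp (((2 : ℝ)⁻¹ • X : so n) : Mat n) := by
    rw [← Matrix.exp_add_of_commute _ _ (Commute.refl _)]
    congr 1
    change (X : Mat n) = (2 : ℝ)⁻¹ • (X : Mat n) + (2 : ℝ)⁻¹ • (X : Mat n)
    rw [← add_smul]
    norm_num
  have h3 := congrArg Matrix.det (key ((2 : ℝ)⁻¹ • X))
  rw [Matrix.det_mul, Matrix.det_mul, Matrix.det_transpose] at h3
  have hJ : (J n).det ≠ 0 := by
    rw [J, Matrix.det_diagonal, Finset.prod_ne_zero_iff]
    intro i _
    split_ifs <;> norm_num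
  rw [h2, Matrix.det_mul]
  apply mul_right_cancel₀ hJ
  linarith

/-- The exponential map `exp : 𝔤 → G`. -/
noncomputable def expG {n : ℕ} (X : so n) : G n :=
  ⟨expGL (X : Mat n), by
    refine ⟨⟨expGL (X : Mat n), expGL_mem X⟩, ?_, rfl⟩
    let γ : ℝ → fullGroup n := fun t => ⟨expGL ((t • X : so n) : Mat n), expGL_mem (t • X)⟩
    have hc : Continuous γ := by
      refine Continuous.subtype_mk ?_ _
      rw [Units.continuous_iff]
      constructor
      · change Continuous fun t : ℝ => NormedSpace.exp (t • (X : Mat n))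
        exact NormedSpace.exp_continuous.comp (continuous_id.smul continuous_const)
      · change Continuous fun t : ℝ => NormedSpace.exp (-(t • (X : Mat n)))
        exact NormedSpace.exp_continuous.comp (continuous_id.smul continuous_const).neg
    have h0 : γ 0 = 1 := by
      apply Subtype.ext
      apply Units.ext
      change NormedSpace.exp (((0 : ℝ) • X : so n) : Mat n) = 1
      simp
    have h1 : γ 1 = ⟨expGL (X : Mat n), expGL_mem X⟩ := by
      simp only [γ, one_smul]
    have := (isPreconnected_range hc).subset_connectedComponent (Set.mem_range_self 0)
      (Set.mem_range_self 1)
    rw [h0, h1] at this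
    exact this⟩

theorem mat_expG {n : ℕ} (X : so n) : mat (expG X) = NormedSpace.exp (X : Mat n) := rfl

theorem mat_mul {n : ℕ} (g h : G n) : mat (g * h) = mat g * mat h := rfl

/-! ### Smooth functions on `G` -/

/-- The open set `U` of matrices and the smooth function `F` of matrices represent `f : G → ℂ` on
`U ∩ G`. -/
def Represents {n : ℕ} (f : G n → ℂ) (U : Set (Entries n)) (F : Entries n → ℂ) : Prop :=
  IsOpen U ∧ ContDiff ℝ ∞ F ∧ ∀ h : G n, ent h ∈ U → f h = F (ent h)

/-- Smoothness of `f : G → ℂ`, with `G` regarded as a submanifold of the space of matrices: near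
every point, `f` is the restriction of a smooth function of matrices. -/
def IsSmooth {n : ℕ} (f : G n → ℂ) : Prop :=
  ∀ g : G n, ∃ U F, ent g ∈ U ∧ Represents f U F

/-- `C^∞(G)`. -/
def SmoothFun (n : ℕ) : Submodule ℝ (G n → ℂ) where
  carrier := {f | IsSmooth f}
  zero_mem' := fun _ => ⟨Set.univ, 0, trivial, isOpen_univ, contDiff_const, fun _ _ => rfl⟩
  add_mem' := by
    intro f f' hf hf' g
    obtain ⟨U, F, hg, hU, hF, h⟩ := hf g
    obtain ⟨U', F', hg', hU', hF', h'⟩ := hf' g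
    exact ⟨U ∩ U', F + F', ⟨hg, hg'⟩, hU.inter hU', hF.add hF', fun x hx => by
      simp [h x hx.1, h' x hx.2]⟩
  smul_mem' := by
    intro c f hf g
    obtain ⟨U, F, hg, hU, hF, h⟩ := hf g
    exact ⟨U, c • F, hg, hU, hF.const_smul c, fun x hx => by simp [h x hx]⟩

/-- Differentiation of a smooth function along a curve in `G`. -/
theorem hasDerivAt_curve {n : ℕ} {f : G n → ℂ} {U : Set (Entries n)} {F : Entries n → ℂ}
    (hf : Represents f U F) {γ : ℝ → G n} {t : ℝ} {w : Entries n} (hU : ent (γ t) ∈ U)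
    (hγ : HasDerivAt (fun s => ent (γ s)) w t) :
    HasDerivAt (fun s => f (γ s)) (fderiv ℝ F (ent (γ t)) w) t := by
  have h1 : HasFDerivAt F (fderiv ℝ F (ent (γ t))) (ent (γ t)) :=
    (hf.2.1.differentiable (by simp) _).hasFDerivAt
  refine (h1.comp_hasDerivAt t hγ).congr_of_eventuallyEq ?_
  filter_upwards [hγ.continuousAt.preimage_mem_nhds (hf.1.mem_nhds hU)] with s hs
  exact hf.2.2 _ hs

theorem hasDerivAt_entries {n : ℕ} {γ : ℝ → Mat n} {w : Mat n} {t : ℝ}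
    (h : HasDerivAt γ w t) :
    HasDerivAt (fun s => (fun i j => γ s i j : Entries n)) (fun i j => w i j : Entries n) t := by
  refine hasDerivAt_pi.2 fun i => hasDerivAt_pi.2 fun j => ?_
  exact (LinearMap.toContinuousLinearMap
    (Matrix.entryLinearMap ℝ ℝ i j)).hasFDerivAt.comp_hasDerivAt t h

/-- Left multiplication of matrices by `y`, in terms of entries. -/
noncomputable def mulL {n : ℕ} (y : Mat n) : Entries n →L[ℝ] Entries n :=
  LinearMap.toContinuousLinearMap
    ((Matrix.ofLinearEquiv ℝ).symm.toLinearMap ∘ₗ LinearMap.mulLeft ℝ y ∘ₗ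
      (Matrix.ofLinearEquiv ℝ).toLinearMap)

/-- Right multiplication of matrices by `y`, in terms of entries. -/
noncomputable def mulR {n : ℕ} (y : Mat n) : Entries n →L[ℝ] Entries n :=
  LinearMap.toContinuousLinearMap
    ((Matrix.ofLinearEquiv ℝ).symm.toLinearMap ∘ₗ LinearMap.mulRight ℝ y ∘ₗ
      (Matrix.ofLinearEquiv ℝ).toLinearMap)

theorem mulL_apply {n : ℕ} (y : Mat n) (x : Entries n) :
    mulL y x = fun i j => (y * Matrix.of x) i j := rfl

theorem mulR_apply {n : ℕ} (y : Mat n) (x : Entries n) :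
    mulR y x = fun i j => (Matrix.of x * y) i j := rfl

theorem mulL_add {n : ℕ} (x y : Mat n) : mulL (x + y) = mulL x + mulL y := by
  ext v : 1
  change Matrix.of.symm ((x + y) * Matrix.of v)
    = Matrix.of.symm (x * Matrix.of v + y * Matrix.of v)
  rw [add_mul]

theorem mulL_smul {n : ℕ} (c : ℝ) (x : Mat n) : mulL (c • x) = c • mulL x := by
  ext v : 1
  change Matrix.of.symm ((c • x) * Matrix.of v) = Matrix.of.symm (c • (x * Matrix.of v))
  rw [Matrix.smul_mul]

theorem mulL_lie {n : ℕ} (x y : Mat n) (v : Entries n) :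
    mulL ⁅x, y⁆ v = mulL x (mulL y v) - mulL y (mulL x v) := by
  change Matrix.of.symm ((x * y - y * x) * Matrix.of v)
    = Matrix.of.symm (x * (y * Matrix.of v) - y * (x * Matrix.of v))
  rw [sub_mul, Matrix.mul_assoc, Matrix.mul_assoc]

theorem mulR_add {n : ℕ} (x y : Mat n) : mulR (x + y) = mulR x + mulR y := by
  ext v : 1
  change Matrix.of.symm (Matrix.of v * (x + y))
    = Matrix.of.symm (Matrix.of v * x + Matrix.of v * y)
  rw [mul_add]

theorem mulR_smul {n : ℕ} (c : ℝ) (x : Mat n) : mulR (c • x) = c • mulR x := by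
  ext v : 1
  change Matrix.of.symm (Matrix.of v * (c • x)) = Matrix.of.symm (c • (Matrix.of v * x))
  rw [Matrix.mul_smul]

theorem mulR_lie {n : ℕ} (x y : Mat n) (v : Entries n) :
    mulR ⁅x, y⁆ v = mulR y (mulR x v) - mulR x (mulR y v) := by
  change Matrix.of.symm (Matrix.of v * (x * y - y * x))
    = Matrix.of.symm ((Matrix.of v * x) * y - (Matrix.of v * y) * x)
  rw [mul_sub, Matrix.mul_assoc, Matrix.mul_assoc]

theorem hasDerivAt_exp_mul {n : ℕ} (y : so n) (g : G n) :
    HasDerivAt (fun t : ℝ => ent (expG (t • y) * g)) (mulL (y : Mat n) (ent g)) 0 := by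
  have h := (hasDerivAt_exp_smul_const (𝕂 := ℝ) (y : Mat n) 0).mul_const (mat g)
  rw [zero_smul, NormedSpace.exp_zero, one_mul] at h
  exact hasDerivAt_entries h

theorem hasDerivAt_mul_exp {n : ℕ} (y : so n) (g : G n) :
    HasDerivAt (fun t : ℝ => ent (g * expG (t • y))) (mulR (y : Mat n) (ent g)) 0 := by
  have h := (hasDerivAt_exp_smul_const (𝕂 := ℝ) (y : Mat n) 0).const_mul (mat g)
  rw [zero_smul, NormedSpace.exp_zero, one_mul] at h
  exact hasDerivAt_entries h

/-- Two successive directional derivatives along linear vector fields. -/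
theorem fderiv_fderiv_apply {n : ℕ} {F : Entries n → ℂ} (hF : ContDiff ℝ ∞ F)
    (V : Entries n →L[ℝ] Entries n) (x v : Entries n) :
    fderiv ℝ (fun h => fderiv ℝ F h (V h)) x v
      = fderiv ℝ (fderiv ℝ F) x v (V x) + fderiv ℝ F x (V v) := by
  have h1 : DifferentiableAt ℝ (fderiv ℝ F) x :=
    (hF.fderiv_right (m := ∞) (by simp)).differentiable (by simp) x
  have h2 := h1.hasFDerivAt.clm_apply (V.hasFDerivAt (x := x))
  rw [h2.fderiv]
  simp [add_comm]

theorem contDiff_fderiv_apply {n : ℕ} {F : Entries n → ℂ} (hF : ContDiff ℝ ∞ F)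
    (V : Entries n →L[ℝ] Entries n) : ContDiff ℝ ∞ (fun h => fderiv ℝ F h (V h)) :=
  (hF.fderiv_right (m := ∞) (by simp)).clm_apply V.contDiff

theorem fderiv_fderiv_symm {n : ℕ} {F : Entries n → ℂ} (hF : ContDiff ℝ ∞ F) (x v w : Entries n) :
    fderiv ℝ (fderiv ℝ F) x v w = fderiv ℝ (fderiv ℝ F) x w v :=
  (hF.contDiffAt.isSymmSndFDerivAt (by simpa using (ENat.LEInfty.out : (2 : WithTop ℕ∞) ≤ ∞))) v w

/-! ### The derived left and right actions of `𝔤` and of `U(𝔤)` on `C^∞(G)` -/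

theorem represents_left {n : ℕ} {f : G n → ℂ} {U : Set (Entries n)} {F : Entries n → ℂ}
    (hf : Represents f U F) (y : so n) :
    Represents (fun g => deriv (fun t : ℝ => f (expG (t • y) * g)) 0) U
      (fun h => fderiv ℝ F h (mulL (y : Mat n) h)) := by
  refine ⟨hf.1, contDiff_fderiv_apply hf.2.1 _, fun h hh => ?_⟩
  have h0 : expG ((0 : ℝ) • y) * h = h := by
    apply Subtype.ext
    apply Units.ext
    change NormedSpace.exp (((0 : ℝ) • y : so n) : Mat n) * mat h = mat h
    simp
  have := hasDerivAt_curve hf (γ := fun t : ℝ => expG (t • y) * h) (t := 0)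
    (by simpa only [h0] using hh) (hasDerivAt_exp_mul y h)
  simp only [h0] at this
  exact this.deriv

theorem represents_right {n : ℕ} {f : G n → ℂ} {U : Set (Entries n)} {F : Entries n → ℂ}
    (hf : Represents f U F) (y : so n) :
    Represents (fun g => deriv (fun t : ℝ => f (g * expG (t • y))) 0) U
      (fun h => fderiv ℝ F h (mulR (y : Mat n) h)) := by
  refine ⟨hf.1, contDiff_fderiv_apply hf.2.1 _, fun h hh => ?_⟩
  have h0 : h * expG ((0 : ℝ) • y) = h := by
    apply Subtype.ext
    apply Units.ext
    change mat h * NormedSpace.exp (((0 : ℝ) • y : so n) : Mat n) = mat h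
    simp
  have := hasDerivAt_curve hf (γ := fun t : ℝ => h * expG (t • y)) (t := 0)
    (by simpa only [h0] using hh) (hasDerivAt_mul_exp y h)
  simp only [h0] at this
  exact this.deriv

theorem represents_eq {n : ℕ} {f : G n → ℂ} {U : Set (Entries n)} {F : Entries n → ℂ}
    (hf : Represents f U F) {g : G n} (hg : ent g ∈ U) : f g = F (ent g) := hf.2.2 g hg

theorem represents_add {n : ℕ} {f f' : G n → ℂ} {U U' : Set (Entries n)} {F F' : Entries n → ℂ}
    (hf : Represents f U F) (hf' : Represents f' U' F') :
    Represents (f + f') (U ∩ U') (F + F') :=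
  ⟨hf.1.inter hf'.1, hf.2.1.add hf'.2.1, fun h hh => by
    simp [hf.2.2 h hh.1, hf'.2.2 h hh.2]⟩

theorem represents_smul {n : ℕ} {f : G n → ℂ} {U : Set (Entries n)} {F : Entries n → ℂ}
    (hf : Represents f U F) (c : ℝ) : Represents (c • f) U (c • F) :=
  ⟨hf.1, hf.2.1.const_smul c, fun h hh => by simp [hf.2.2 h hh]⟩

theorem differentiableAt_of_represents {n : ℕ} {f : G n → ℂ} {U : Set (Entries n)} {F : Entries n → ℂ}
    (hf : Represents f U F) (x : Entries n) : DifferentiableAt ℝ F x :=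
  hf.2.1.differentiable (by simp) x

/-- The operator `𝔏_y f (g) = d/dt f (exp (t y) g)` at `t = 0`, for `y ∈ 𝔤`. -/
noncomputable def leftDeriv {n : ℕ} (y : so n) : Module.End ℝ (SmoothFun n) where
  toFun f := ⟨fun g => deriv (fun t : ℝ => (f : G n → ℂ) (expG (t • y) * g)) 0, fun g => by
    obtain ⟨U, F, hg, hF⟩ := f.2 g
    exact ⟨U, _, hg, represents_left hF y⟩⟩
  map_add' f f' := by
    ext g
    obtain ⟨U, F, hg, hF⟩ := f.2 g
    obtain ⟨U', F', hg', hF'⟩ := f'.2 g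
    change deriv (fun t : ℝ => ((f : G n → ℂ) + (f' : G n → ℂ)) (expG (t • y) * g)) 0
      = deriv (fun t : ℝ => (f : G n → ℂ) (expG (t • y) * g)) 0
        + deriv (fun t : ℝ => (f' : G n → ℂ) (expG (t • y) * g)) 0
    rw [represents_eq (represents_left (represents_add hF hF') y) ⟨hg, hg'⟩,
      represents_eq (represents_left hF y) hg, represents_eq (represents_left hF' y) hg',
      fderiv_add (differentiableAt_of_represents hF _) (differentiableAt_of_represents hF' _)]
    rfl
  map_smul' c f := by
    ext g
    obtain ⟨U, F, hg, hF⟩ := f.2 g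
    change deriv (fun t : ℝ => (c • (f : G n → ℂ)) (expG (t • y) * g)) 0
      = c • deriv (fun t : ℝ => (f : G n → ℂ) (expG (t • y) * g)) 0
    rw [represents_eq (represents_left (represents_smul hF c) y) hg,
      represents_eq (represents_left hF y) hg,
      fderiv_const_smul (differentiableAt_of_represents hF _)]
    rfl

/-- The operator `ℜ_y f (g) = d/dt f (g exp (t y))` at `t = 0`, for `y ∈ 𝔤`. -/
noncomputable def rightDeriv {n : ℕ} (y : so n) : Module.End ℝ (SmoothFun n) where
  toFun f := ⟨fun g => deriv (fun t : ℝ => (f : G n → ℂ) (g * expG (t • y))) 0, fun g => by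
    obtain ⟨U, F, hg, hF⟩ := f.2 g
    exact ⟨U, _, hg, represents_right hF y⟩⟩
  map_add' f f' := by
    ext g
    obtain ⟨U, F, hg, hF⟩ := f.2 g
    obtain ⟨U', F', hg', hF'⟩ := f'.2 g
    change deriv (fun t : ℝ => ((f : G n → ℂ) + (f' : G n → ℂ)) (g * expG (t • y))) 0
      = deriv (fun t : ℝ => (f : G n → ℂ) (g * expG (t • y))) 0
        + deriv (fun t : ℝ => (f' : G n → ℂ) (g * expG (t • y))) 0
    rw [represents_eq (represents_right (represents_add hF hF') y) ⟨hg, hg'⟩,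
      represents_eq (represents_right hF y) hg, represents_eq (represents_right hF' y) hg',
      fderiv_add (differentiableAt_of_represents hF _) (differentiableAt_of_represents hF' _)]
    rfl
  map_smul' c f := by
    ext g
    obtain ⟨U, F, hg, hF⟩ := f.2 g
    change deriv (fun t : ℝ => (c • (f : G n → ℂ)) (g * expG (t • y))) 0
      = c • deriv (fun t : ℝ => (f : G n → ℂ) (g * expG (t • y))) 0
    rw [represents_eq (represents_right (represents_smul hF c) y) hg,
      represents_eq (represents_right hF y) hg,
      fderiv_const_smul (differentiableAt_of_represents hF _)]
    rfl

/-- `y ↦ 𝔏_y` reverses brackets, so it is a Lie algebra morphism into the opposite algebra. -/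
noncomputable def leftDerivHom (n : ℕ) : so n →ₗ⁅ℝ⁆ (Module.End ℝ (SmoothFun n))ᵐᵒᵖ where
  toFun y := MulOpposite.op (leftDeriv y)
  map_add' x y := by
    rw [← MulOpposite.op_add]
    congr 1
    ext f g
    obtain ⟨U, F, hg, hF⟩ := f.2 g
    refine (represents_eq (represents_left hF (x + y)) hg).trans ?_
    refine Eq.trans ?_ (congrArg₂ (· + ·) (represents_eq (represents_left hF x) hg)
      (represents_eq (represents_left hF y) hg)).symm
    exact (congrArg (fun V => fderiv ℝ F (ent g) (V (ent g))) (mulL_add (x : Mat n) y)).trans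
      (map_add _ _ _)
  map_smul' c y := by
    rw [RingHom.id_apply, ← MulOpposite.op_smul]
    congr 1
    ext f g
    obtain ⟨U, F, hg, hF⟩ := f.2 g
    refine (represents_eq (represents_left hF (c • y)) hg).trans ?_
    refine Eq.trans ?_ (congrArg (c • ·) (represents_eq (represents_left hF y) hg)).symm
    exact (congrArg (fun V => fderiv ℝ F (ent g) (V (ent g))) (mulL_smul c (y : Mat n))).trans
      ((fderiv ℝ F (ent g)).map_smul c _)
  map_lie' := by
    intro x y
    rw [LieRing.of_associative_ring_bracket, ← MulOpposite.op_mul, ← MulOpposite.op_mul,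
      ← MulOpposite.op_sub]
    congr 1
    ext f g
    obtain ⟨U, F, hg, hF⟩ := f.2 g
    refine (represents_eq (represents_left hF ⁅x, y⁆) hg).trans ?_
    refine Eq.trans ?_ (congrArg₂ (· - ·)
      (represents_eq (represents_left (represents_left hF x) y) hg)
      (represents_eq (represents_left (represents_left hF y) x) hg)).symm
    rw [fderiv_fderiv_apply hF.2.1, fderiv_fderiv_apply hF.2.1, fderiv_fderiv_symm hF.2.1]
    rw [LieSubalgebra.coe_bracket, mulL_lie, map_sub]
    ring

/-- `y ↦ ℜ_y` is a Lie algebra morphism. -/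
noncomputable def rightDerivHom (n : ℕ) : so n →ₗ⁅ℝ⁆ Module.End ℝ (SmoothFun n) where
  toFun y := rightDeriv y
  map_add' x y := by
    ext f g
    obtain ⟨U, F, hg, hF⟩ := f.2 g
    refine (represents_eq (represents_right hF (x + y)) hg).trans ?_
    refine Eq.trans ?_ (congrArg₂ (· + ·) (represents_eq (represents_right hF x) hg)
      (represents_eq (represents_right hF y) hg)).symm
    exact (congrArg (fun V => fderiv ℝ F (ent g) (V (ent g))) (mulR_add (x : Mat n) y)).trans
      (map_add _ _ _)
  map_smul' c y := by
    ext f g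
    obtain ⟨U, F, hg, hF⟩ := f.2 g
    refine (represents_eq (represents_right hF (c • y)) hg).trans ?_
    refine Eq.trans ?_ (congrArg (c • ·) (represents_eq (represents_right hF y) hg)).symm
    exact (congrArg (fun V => fderiv ℝ F (ent g) (V (ent g))) (mulR_smul c (y : Mat n))).trans
      ((fderiv ℝ F (ent g)).map_smul c _)
  map_lie' := by
    intro x y
    rw [LieRing.of_associative_ring_bracket]
    ext f g
    obtain ⟨U, F, hg, hF⟩ := f.2 g
    refine (represents_eq (represents_right hF ⁅x, y⁆) hg).trans ?_
    refine Eq.trans ?_ (congrArg₂ (· - ·)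
      (represents_eq (represents_right (represents_right hF y) x) hg)
      (represents_eq (represents_right (represents_right hF x) y) hg)).symm
    rw [fderiv_fderiv_apply hF.2.1, fderiv_fderiv_apply hF.2.1, fderiv_fderiv_symm hF.2.1]
    rw [LieSubalgebra.coe_bracket, mulR_lie, map_sub]
    ring

/-- `𝔏_u` for `u ∈ U(𝔤)`: the extension of `y ↦ 𝔏_y` to an algebra anti-homomorphism. -/
noncomputable def leftOp {n : ℕ} (u : UniversalEnvelopingAlgebra ℝ (so n)) :
    Module.End ℝ (SmoothFun n) :=
  MulOpposite.unop (UniversalEnvelopingAlgebra.lift ℝ (leftDerivHom n) u)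

/-- `ℜ_u` for `u ∈ U(𝔤)`: the extension of `y ↦ ℜ_y` to an algebra homomorphism. -/
noncomputable def rightOp {n : ℕ} (u : UniversalEnvelopingAlgebra ℝ (so n)) :
    Module.End ℝ (SmoothFun n) :=
  UniversalEnvelopingAlgebra.lift ℝ (rightDerivHom n) u

/-- The right translate `R_h f (g) = f (g h)`. -/
def rightTranslate {n : ℕ} (h : G n) (f : SmoothFun n) : SmoothFun n :=
  ⟨fun g => (f : G n → ℂ) (g * h), fun g => by
    obtain ⟨U, F, hg, hU, hF, hf⟩ := f.2 (g * h)
    refine ⟨(fun x => mulR (mat h) x) ⁻¹' U, fun x => F (mulR (mat h) x), hg,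
      hU.preimage (mulR (mat h)).continuous, hF.comp (mulR (mat h)).contDiff, fun x hx => ?_⟩
    exact hf (x * h) hx⟩

end Exp

/-! ### The Casimir elements -/

/-- `Ω = -∑ Kᵢ² + ∑ Pⱼ² ∈ U(𝔤)`, for an orthonormal basis `Kᵢ` of `𝔨` and an orthonormal basis
`Pⱼ` of `𝔭`. -/
noncomputable def casimir {n : ℕ} {ι κ : Type*} [Fintype ι] [Fintype κ] (K : ι → so n)
    (P : κ → so n) : UniversalEnvelopingAlgebra ℝ (so n) :=
  -∑ i, UniversalEnvelopingAlgebra.ι ℝ (K i) ^ 2 + ∑ j, UniversalEnvelopingAlgebra.ι ℝ (P j) ^ 2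

/-- `Ω_M = -∑ mⱼ² ∈ U(𝔪)`, for an orthonormal basis `mⱼ` of `𝔪`. -/
noncomputable def casimirM {n : ℕ} [NeZero n] {ι : Type*} [Fintype ι] (b : ι → mAlg n) :
    UniversalEnvelopingAlgebra ℝ (mAlg n) :=
  -∑ j, UniversalEnvelopingAlgebra.ι ℝ (b j) ^ 2

/-- The canonical morphism `U(𝔪) → U(𝔤)`. -/
noncomputable def fromM (n : ℕ) [NeZero n] :
    UniversalEnvelopingAlgebra ℝ (mAlg n) →ₐ[ℝ] UniversalEnvelopingAlgebra ℝ (so n) :=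
  UniversalEnvelopingAlgebra.lift ℝ
    ((UniversalEnvelopingAlgebra.ι ℝ : so n →ₗ⁅ℝ⁆ _).comp (mAlg n).incl)

/-! ### Iwasawa coordinates -/

/-- `K = {g ∈ G | gᵀ g = 1}`, which is `SO(n)` in the upper left block. -/
def KGroup (n : ℕ) : Set (G n) := {g | (mat g)ᵀ * mat g = 1}

/-- `N = exp 𝔫`. -/
def NGroup (n : ℕ) [NeZero n] : Set (G n) := {g | ∃ X ∈ nSub n, g = expG X}

/-- `g = k a ν` with `k ∈ K`, `a = exp (t a₁)` and `ν ∈ N`. -/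
def IsIwasawa {n : ℕ} [NeZero n] (g k : G n) (t : ℝ) (ν : G n) : Prop :=
  k ∈ KGroup n ∧ ν ∈ NGroup n ∧ g = k * expG (t • a₁ n) * ν

open Classical in
/-- The coordinates `(k, t, ν)` of the Iwasawa decomposition `g = k exp (t a₁) ν`; the value in the
last line is never used, because every element of `G` has a unique Iwasawa decomposition. -/
noncomputable def iwasawa {n : ℕ} [NeZero n] (g : G n) : G n × ℝ × G n :=
  if h : ∃ q : G n × ℝ × G n, IsIwasawa g q.1 q.2.1 q.2.2 then h.choose
  else (1, 0, 1)

/-- `𝔎_x f (k a ν) = d/ds f (k exp (s x) a ν)` at `s = 0`, for `x ∈ 𝔨`. -/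
noncomputable def opK {n : ℕ} [NeZero n] (x : kAlg n) (f : G n → ℂ) (g : G n) : ℂ :=
  deriv (fun s : ℝ => f ((iwasawa g).1 * expG (s • (x : so n)) *
    expG ((iwasawa g).2.1 • a₁ n) * (iwasawa g).2.2)) 0

/-- `𝔄_{a₁} f (k a ν) = d/ds f (k exp (s a₁) a ν)` at `s = 0`. -/
noncomputable def opA {n : ℕ} [NeZero n] (f : G n → ℂ) (g : G n) : ℂ :=
  deriv (fun s : ℝ => f ((iwasawa g).1 * expG (s • a₁ n) *
    expG ((iwasawa g).2.1 • a₁ n) * (iwasawa g).2.2)) 0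

/-- `𝔑_x f (k a ν) = d/ds f (k a exp (s x) ν)` at `s = 0`, for `x ∈ 𝔫`. -/
noncomputable def opN {n : ℕ} [NeZero n] (x : nSub n) (f : G n → ℂ) (g : G n) : ℂ :=
  deriv (fun s : ℝ => f ((iwasawa g).1 * expG ((iwasawa g).2.1 • a₁ n) *
    expG (s • (x : so n)) * (iwasawa g).2.2)) 0

/-- The extension of `x ↦ 𝔎_x` to the enveloping algebra: `𝔎_u f (k a ν) = (ℜ_u (R_{a ν} f)) (k)`.
It is used for `u` in the image of `U(𝔨)`. -/
noncomputable def opKEnv {n : ℕ} [NeZero n] (u : UniversalEnvelopingAlgebra ℝ (so n))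
    (f : SmoothFun n) (g : G n) : ℂ :=
  (rightOp u (rightTranslate (expG ((iwasawa g).2.1 • a₁ n) * (iwasawa g).2.2) f) : G n → ℂ)
    (iwasawa g).1

/-- On `𝔨` itself the extension is `𝔎_x`. -/
theorem opKEnv_ι {n : ℕ} [NeZero n] (x : kAlg n) (f : SmoothFun n) (g : G n) :
    opKEnv (UniversalEnvelopingAlgebra.ι ℝ (x : so n)) f g = opK x f g := by
  simp only [opKEnv, rightOp, UniversalEnvelopingAlgebra.lift_ι_apply, opK, mul_assoc]
  change deriv (fun s : ℝ => (f : G n → ℂ) ((iwasawa g).1 * expG (s • (x : so n)) *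
    (expG ((iwasawa g).2.1 • a₁ n) * (iwasawa g).2.2))) 0 = _
  simp only [mul_assoc]

end LorentzCasimir

open LorentzCasimir

namespace LorentzCasimir

/-! ### The inner product on `𝔤` -/

/-! Fix `g = kh` with `h = aν` and let `F` be the right translate of `f` by `h`. Since `exp(sy)k = k
exp(s Ad(k⁻¹)y)`, the operator `𝔏_y²` applied to `f` at `g` is the square of the right derivative
along `Ad(k⁻¹)y`, applied to `F` at `k` (`leftDeriv_leftDeriv`). As `k` is orthogonal, `Ad(k⁻¹)`
commutes with `θ`, so it preserves `𝔨`, `𝔭` and the inner product; and a sum `∑ Q(bᵢ,bᵢ)` with `Q`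
bilinear does not depend on the orthonormal basis (`IsOrthonormal.sum_eq_sum`). The rotated bases
can therefore be exchanged for adapted ones: the `kᵢ` with a basis of `𝔪`, and the `pᵢ = (nᵢ -
θnᵢ)/√2` with `a₁`.

The formula is then algebra (`casimir_sum_eq`). From `pᵢ = √2 nᵢ - kᵢ` one gets `pᵢ² - kᵢ² = 2nᵢ² -
2√2 kᵢnᵢ - √2[nᵢ,kᵢ]`, and `[nᵢ,θnᵢ] = -a₁` makes the last term `+a₁`; the `n-1` indices produce the
first-order term. This needs `a₁` to be a unit vector (`innerProd_a₁`), which holds because `(ad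
a₁)²` is a projection of rank `2(n-1)`. The spectral facts all come from `(ad a₁)³ = ad a₁`
(`lie_a₁_cubed`).

Finally `a exp(x) = exp(e^t x) a` for `x ∈ 𝔫` turns `𝔑_x` into a right derivative at `k` along `e^t
x`, which the powers of `e^{-t}` undo. That the coordinates are well defined follows from the action
on the time-like basis vector: `K` is its stabilizer and `NA` acts simply transitively on the upper
sheet of the hyperboloid (`existsUnique_isIwasawa`). -/

/-- The Cartan involution as an automorphism of the Lie algebra `𝔤`. -/
def thetaEquiv (n : ℕ) : so n ≃ₗ⁅ℝ⁆ so n :=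
  { theta n with
    map_lie' := fun {X Y} => theta_lie X Y
    invFun := theta n
    left_inv := theta_theta
    right_inv := theta_theta }

/-- `innerProd` as a bilinear form. -/
noncomputable def innerForm (n : ℕ) : LinearMap.BilinForm ℝ (so n) :=
  (-(2 * ((n : ℝ) - 1))⁻¹) • (killingForm ℝ (so n)).compl₂ (theta n)

theorem innerForm_apply {n : ℕ} (X Y : so n) : innerForm n X Y = innerProd n X Y := by
  simp only [innerForm, innerProd, form, LinearMap.smul_apply, LinearMap.compl₂_apply, smul_eq_mul]
  ring

theorem innerProd_add_left {n : ℕ} (X Y Z : so n) :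
    innerProd n (X + Y) Z = innerProd n X Z + innerProd n Y Z := by
  simp only [← innerForm_apply, map_add, LinearMap.add_apply]

theorem innerProd_smul_left {n : ℕ} (c : ℝ) (X Z : so n) :
    innerProd n (c • X) Z = c * innerProd n X Z := by
  simp only [← innerForm_apply, map_smul, LinearMap.smul_apply, smul_eq_mul]

/-- The Killing form is invariant under every automorphism; commuting with `θ` handles the twist in
the second argument. Applied to `θ` itself and to `Ad k` for `k ∈ K`. -/
theorem innerProd_equiv {n : ℕ} (e : so n ≃ₗ⁅ℝ⁆ so n) (he : ∀ X, e (theta n X) = theta n (e X))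
    (X Y : so n) : innerProd n (e X) (e Y) = innerProd n X Y := by
  simp only [innerProd, form, ← he, LieAlgebra.killingForm_of_equiv_apply]

theorem innerProd_theta {n : ℕ} (X Y : so n) :
    innerProd n (theta n X) (theta n Y) = innerProd n X Y :=
  innerProd_equiv (thetaEquiv n) (fun _ => rfl) X Y

theorem innerProd_comm {n : ℕ} (X Y : so n) : innerProd n X Y = innerProd n Y X := by
  rw [← innerProd_theta]
  simp only [innerProd, form, theta_theta]
  rw [LieModule.traceForm_comm]

theorem innerProd_add_right {n : ℕ} (X Y Z : so n) :
    innerProd n X (Y + Z) = innerProd n X Y + innerProd n X Z := by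
  simp only [← innerForm_apply, map_add]

theorem innerProd_smul_right {n : ℕ} (c : ℝ) (X Z : so n) :
    innerProd n X (c • Z) = c * innerProd n X Z := by
  simp only [← innerForm_apply, map_smul, smul_eq_mul]

theorem innerProd_neg_right {n : ℕ} (X Z : so n) :
    innerProd n X (-Z) = -innerProd n X Z := by
  simp only [← innerForm_apply, map_neg]

theorem innerProd_neg_left {n : ℕ} (X Z : so n) :
    innerProd n (-X) Z = -innerProd n X Z := by
  simp only [← innerForm_apply, map_neg, LinearMap.neg_apply]

/-- Invariance of the Killing form: the adjoint of `ad X` is `-ad θX`. In particular `ad a₁` is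
self-adjoint. -/
theorem innerProd_lie_left {n : ℕ} (X Y Z : so n) :
    innerProd n ⁅X, Y⁆ Z = -innerProd n Y ⁅theta n X, Z⁆ := by
  simp only [innerProd, form, theta_lie, theta_theta]
  rw [← lie_skew X Y, map_neg, LinearMap.neg_apply, LieModule.traceForm_apply_lie_apply]
  ring

/-! ### The action of `a₁` on `𝔤` -/

theorem zero_ne_last {n : ℕ} [NeZero n] : (0 : Fin (n + 1)) ≠ Fin.last n := by
  intro h
  exact NeZero.ne n (by simpa [Fin.ext_iff] using h.symm)

theorem so_apply {n : ℕ} (X : so n) (i j : Fin (n + 1)) :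
    (X : Mat n) j i * (if j = Fin.last n then -1 else 1)
      + (if i = Fin.last n then -1 else 1) * (X : Mat n) i j = 0 := by
  have h := congrFun (congrFun X.2.1 i) j
  simpa [J, Matrix.mul_diagonal, Matrix.diagonal_mul] using h

theorem so_diag {n : ℕ} (X : so n) (i : Fin (n + 1)) : (X : Mat n) i i = 0 := by
  have h := so_apply X i i
  split_ifs at h <;> linarith

theorem so_last {n : ℕ} (X : so n) (i : Fin (n + 1)) :
    (X : Mat n) (Fin.last n) i = (X : Mat n) i (Fin.last n) := by
  by_cases hi : i = Fin.last n
  · rw [hi]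
  · have h := so_apply X i (Fin.last n)
    simp only [hi, if_true, if_false] at h
    linarith

theorem so_skew {n : ℕ} (X : so n) {i j : Fin (n + 1)} (hi : i ≠ Fin.last n)
    (hj : j ≠ Fin.last n) : (X : Mat n) i j = -(X : Mat n) j i := by
  have h := so_apply X i j
  simp only [hi, hj, if_false] at h
  linarith

theorem theta_coe {n : ℕ} (X : so n) : (theta n X : Mat n) = -(X : Mat n)ᵀ := rfl

theorem coe_a₁ (n : ℕ) [NeZero n] :
    (a₁ n : Mat n) = Matrix.single 0 (Fin.last n) 1 + Matrix.single (Fin.last n) 0 1 := rfl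

theorem theta_a₁ (n : ℕ) [NeZero n] : theta n (a₁ n) = -a₁ n := by
  ext1
  simp [theta_coe, coe_a₁, Matrix.transpose_add, add_comm]

/-- Only the block of `X` on the indices `0` and `last` survives, and that block is symmetric with
zero diagonal. -/
theorem a₁_mul_mul_a₁ {n : ℕ} [NeZero n] (X : so n) :
    (a₁ n : Mat n) * X * a₁ n = (X : Mat n) 0 (Fin.last n) • (a₁ n : Mat n) := by
  simp only [coe_a₁, add_mul, mul_add, Matrix.single_mul_mul_single, so_diag, so_last X 0]
  simp only [mul_zero, one_mul, mul_one, Matrix.single_zero, zero_add, add_zero,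
    smul_add, Matrix.smul_single, smul_eq_mul]

theorem a₁_pow_three (n : ℕ) [NeZero n] :
    (a₁ n : Mat n) * a₁ n * a₁ n = a₁ n := by
  rw [a₁_mul_mul_a₁]
  simp [coe_a₁, NeZero.ne n]

/-- Expanding the cube of left minus right multiplication by `a = a₁`, the mixed terms `a²Xa` and
`aXa²` both equal `c a²` and cancel, while `a³ = a`. So `ad a₁` has eigenvalues among `-1, 0, 1`,
and polynomials in it give the spectral projections. -/
theorem lie_a₁_cubed {n : ℕ} [NeZero n] (X : so n) :
    ⁅a₁ n, ⁅a₁ n, ⁅a₁ n, X⁆⁆⁆ = ⁅a₁ n, X⁆ := by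
  ext1
  simp only [LieSubalgebra.coe_bracket, LieRing.of_associative_ring_bracket]
  have h1 := a₁_mul_mul_a₁ X
  have h2 := a₁_pow_three n
  generalize (a₁ n : Mat n) = a at *
  generalize (X : Mat n) 0 (Fin.last n) = c at *
  generalize (X : Mat n) = X at *
  have h3 : a * a * X * a = c • (a * a) := by
    rw [mul_assoc a a X, mul_assoc a, h1, Matrix.mul_smul]
  have h4 : a * X * a * a = c • (a * a) := by rw [h1, Matrix.smul_mul]
  calc a * (a * (a * X - X * a) - (a * X - X * a) * a)
        - (a * (a * X - X * a) - (a * X - X * a) * a) * a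
      = a * a * a * X - (3 : ℕ) • (a * a * X * a) + (3 : ℕ) • (a * X * a * a)
        - X * (a * a * a) := by noncomm_ring
    _ = a * X - X * a := by rw [h2, h3, h4]; noncomm_ring

/-- A symmetric element of `𝔤` that commutes with `a₁` is a multiple of `a₁`. -/
theorem eq_smul_a₁ {n : ℕ} [NeZero n] {X : so n} (hp : theta n X = -X) (h0 : ⁅a₁ n, X⁆ = 0) :
    X = (X : Mat n) 0 (Fin.last n) • a₁ n := by
  have hsymm : ∀ i j, (X : Mat n) i j = (X : Mat n) j i := by
    intro i j
    have h := congrFun (congrFun (congrArg Subtype.val hp) j) i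
    simpa [theta_coe] using h
  have hcomm : (a₁ n : Mat n) * X = (X : Mat n) * a₁ n := by
    have h := congrArg Subtype.val h0
    exact sub_eq_zero.1 h
  -- Row `0` of `a₁X` is the last row of `X`, while row `0` of `Xa₁` vanishes away from the columns
  -- `0` and `last`.
  have hl : ∀ j, j ≠ 0 → j ≠ Fin.last n → (X : Mat n) (Fin.last n) j = 0 := by
    intro j hj hj'
    have h := congrFun (congrFun hcomm 0) j
    simpa [coe_a₁, Matrix.add_mul, Matrix.mul_add, hj, hj',
      Matrix.single_mul_apply_of_ne _ _ _ _ _ (zero_ne_last (n := n))] using h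
  ext i j
  change (X : Mat n) i j = (X : Mat n) 0 (Fin.last n) * (a₁ n : Mat n) i j
  have hz := @zero_ne_last n _
  by_cases hi : i = Fin.last n
  · subst hi
    by_cases hj : j = Fin.last n
    · subst hj
      simp [so_diag]
    · by_cases hj0 : j = 0
      · subst hj0
        simp [coe_a₁, hz, so_last]
      · rw [hl j hj0 hj]
        simp [coe_a₁, hz, Ne.symm hj0, Ne.symm hj]
  · by_cases hj : j = Fin.last n
    · subst hj
      by_cases hi0 : i = 0
      · subst hi0
        simp [coe_a₁, hz, hz.symm]
      · rw [hsymm, hl i hi0 hi]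
        simp [coe_a₁, hz, Ne.symm hi0, Ne.symm hi]
    -- The space-like block is both skew and symmetric.
    · have h1 := so_skew X hi hj
      rw [hsymm j i] at h1
      have h2 : (X : Mat n) i j = 0 := by linarith
      rw [h2]
      simp [coe_a₁, Ne.symm hi, Ne.symm hj]

/-- The bracket would be an eigenvector of `ad a₁` for the eigenvalue `2`, which `(ad a₁)³ = ad a₁`
excludes. -/
theorem lie_eq_zero_of_mem_nSub {n : ℕ} [NeZero n] {X Y : so n} (hX : X ∈ nSub n)
    (hY : Y ∈ nSub n) : ⁅X, Y⁆ = 0 := by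
  have hX' : ⁅a₁ n, X⁆ = X := hX
  have hY' : ⁅a₁ n, Y⁆ = Y := hY
  have h : ⁅a₁ n, ⁅X, Y⁆⁆ = (2 : ℝ) • ⁅X, Y⁆ := by
    rw [leibniz_lie, hX', hY', two_smul]
  have h3 := lie_a₁_cubed ⁅X, Y⁆
  rw [h, lie_smul, h, lie_smul, lie_smul, h, smul_smul, smul_smul, ← sub_eq_zero, ← sub_smul] at h3
  exact (smul_eq_zero.1 h3).resolve_left (by norm_num)

theorem lie_a₁_theta {n : ℕ} [NeZero n] (X : so n) :
    ⁅a₁ n, theta n X⁆ = -theta n ⁅a₁ n, X⁆ := by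
  rw [theta_lie, theta_a₁, neg_lie, neg_neg]

/-- The component in `𝔫` of an element of `𝔤`. -/
noncomputable def nPart {n : ℕ} [NeZero n] (X : so n) : nSub n :=
  -- The polynomial `(s² + s)/2` is `1` at `1` and `0` at `0` and `-1`.
  ⟨(2 : ℝ)⁻¹ • (⁅a₁ n, ⁅a₁ n, X⁆⁆ + ⁅a₁ n, X⁆), by
    change ⁅a₁ n, _⁆ = _
    rw [lie_smul, lie_add, lie_a₁_cubed]
    exact congrArg _ (add_comm _ _)⟩

theorem coe_nPart {n : ℕ} [NeZero n] (X : so n) :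
    (nPart X : so n) = (2 : ℝ)⁻¹ • (⁅a₁ n, ⁅a₁ n, X⁆⁆ + ⁅a₁ n, X⁆) := rfl

/-- For `X ∈ 𝔫`, the vector `(X - θ X) / √2` of `𝔭`. -/
noncomputable def pVec {n : ℕ} [NeZero n] (X : nSub n) : pSub n :=
  ⟨(Real.sqrt 2)⁻¹ • ((X : so n) - theta n X), by
    change theta n _ = _
    rw [map_smul, map_sub, theta_theta, ← smul_neg, neg_sub]⟩

theorem coe_kVec {n : ℕ} [NeZero n] (X : nSub n) :
    (kVec X : so n) = (Real.sqrt 2)⁻¹ • ((X : so n) + theta n X) := rfl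

theorem coe_pVec {n : ℕ} [NeZero n] (X : nSub n) :
    (pVec X : so n) = (Real.sqrt 2)⁻¹ • ((X : so n) - theta n X) := rfl

/-- Split `X` by the projections `(ad a₁)²` and `1 - (ad a₁)²`. The second lands in `𝔪`; the first
is the `𝔫`-part plus its image under `θ`, because `θ` swaps the eigenvalues `1` and `-1`. The factor
`√2` cancels the normalization in `kVec`. -/
theorem exists_kAlg_decomposition {n : ℕ} [NeZero n] {X : so n} (hX : X ∈ kAlg n) :
    ∃ Y : nSub n, ∃ Z : mAlg n, X = kVec Y + (Z : so n) := by
  have hX' : theta n X = X := hX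
  have hθ : theta n ⁅a₁ n, X⁆ = -⁅a₁ n, X⁆ := by rw [theta_lie, theta_a₁, hX', neg_lie]
  have hθ2 : theta n ⁅a₁ n, ⁅a₁ n, X⁆⁆ = ⁅a₁ n, ⁅a₁ n, X⁆⁆ := by
    rw [theta_lie, theta_a₁, hθ, neg_lie, lie_neg, neg_neg]
  have hk : theta n (X - ⁅a₁ n, ⁅a₁ n, X⁆⁆) = X - ⁅a₁ n, ⁅a₁ n, X⁆⁆ := by rw [map_sub, hX', hθ2]
  refine ⟨Real.sqrt 2 • nPart X,
    ⟨X - ⁅a₁ n, ⁅a₁ n, X⁆⁆, hk, by rw [lie_sub, lie_a₁_cubed, sub_self]⟩, ?_⟩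
  · change _ = _ + (X - ⁅a₁ n, ⁅a₁ n, X⁆⁆)
    rw [coe_kVec, Submodule.coe_smul, map_smul, ← smul_add, smul_smul,
      inv_mul_cancel₀ (by positivity), one_smul, coe_nPart, map_smul, map_add, hθ, hθ2, ← smul_add]
    module

/-- The same splitting in `𝔭`, where the centralizer of `a₁` is only `ℝa₁`: the real rank is one. -/
theorem exists_pSub_decomposition {n : ℕ} [NeZero n] {X : so n} (hX : X ∈ pSub n) :
    ∃ Y : nSub n, ∃ c : ℝ, X = pVec Y + c • a₁ n := by
  have hX' : theta n X = -X := hX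
  have hθ : theta n ⁅a₁ n, X⁆ = ⁅a₁ n, X⁆ := by rw [theta_lie, theta_a₁, hX', neg_lie, lie_neg,
    neg_neg]
  have hθ2 : theta n ⁅a₁ n, ⁅a₁ n, X⁆⁆ = -⁅a₁ n, ⁅a₁ n, X⁆⁆ := by
    rw [theta_lie, theta_a₁, hθ, neg_lie]
  have h0 := eq_smul_a₁ (X := X - ⁅a₁ n, ⁅a₁ n, X⁆⁆) (by rw [map_sub, hX', hθ2]; abel)
    (by rw [lie_sub, lie_a₁_cubed, sub_self])
  refine ⟨Real.sqrt 2 • nPart X, ((X - ⁅a₁ n, ⁅a₁ n, X⁆⁆ : so n) : Mat n) 0 (Fin.last n), ?_⟩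
  · rw [← h0, coe_pVec, Submodule.coe_smul, map_smul, ← smul_sub, smul_smul,
      inv_mul_cancel₀ (by positivity), one_smul, coe_nPart, map_smul, map_add, hθ, hθ2, ← smul_sub]
    module

/-! ### Orthogonality relations -/

/-- Eigenspaces of `ad a₁` are orthogonal. -/
theorem innerProd_eq_zero_of_lie_a₁ {n : ℕ} [NeZero n] {X Y : so n} {c d : ℝ}
    (hX : ⁅a₁ n, X⁆ = c • X) (hY : ⁅a₁ n, Y⁆ = d • Y) (hcd : c ≠ d) : innerProd n X Y = 0 := by
  have h := innerProd_lie_left (a₁ n) X Y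
  rw [theta_a₁, neg_lie, innerProd_neg_right, neg_neg, hX, hY, innerProd_smul_left,
    innerProd_smul_right, ← sub_eq_zero, ← sub_mul] at h
  exact (mul_eq_zero.1 h).resolve_left (sub_ne_zero.2 hcd)

/-- The Killing form at `a₁` is the trace of `(ad a₁)²`, a projection onto `𝔫 ⊕ θ𝔫`, hence `2(n-1)`.
This is what the normalization of the form is chosen for. -/
theorem innerProd_a₁ {n : ℕ} [NeZero n] (hn : 2 ≤ n) (h : Module.finrank ℝ (nSub n) = n - 1) :
    innerProd n (a₁ n) (a₁ n) = 1 := by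
  have hn' : (2 : ℝ) ≤ n := by exact_mod_cast hn
  let E := LieAlgebra.ad ℝ (so n) (a₁ n)
  let p : Submodule ℝ (so n) := nSub n ⊔ (nSub n).map (theta n)
  have hinj : Function.Injective (theta n) := Function.LeftInverse.injective theta_theta
  have hm : ∀ X ∈ (nSub n).map (theta n), ⁅a₁ n, X⁆ = -X := by
    rintro _ ⟨X, hX, rfl⟩
    rw [lie_a₁_theta, show ⁅a₁ n, X⁆ = X from hX]
  have hp : LinearMap.IsProj p (E ∘ₗ E) := by
    refine ⟨fun X => ?_, fun X hX => ?_⟩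
    · have : (E ∘ₗ E) X = nPart X + theta n (nPart (theta n X)) := by
        change ⁅a₁ n, ⁅a₁ n, X⁆⁆ = _
        rw [coe_nPart, coe_nPart, lie_a₁_theta, lie_neg, lie_a₁_theta, neg_neg, map_smul, map_add,
          map_neg, theta_theta, theta_theta]
        module
      rw [this]
      exact Submodule.add_mem_sup (nPart X).2 (Submodule.mem_map_of_mem (nPart _).2)
    · obtain ⟨Y, hY, Z, hZ, rfl⟩ := Submodule.mem_sup.1 hX
      change ⁅a₁ n, ⁅a₁ n, Y + Z⁆⁆ = _
      rw [lie_add, lie_add, show ⁅a₁ n, Y⁆ = Y from hY, hm Z hZ, lie_neg, hm Z hZ, neg_neg,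
        show ⁅a₁ n, Y⁆ = Y from hY]
  have hdisj : nSub n ⊓ (nSub n).map (theta n) = ⊥ := by
    rw [Submodule.eq_bot_iff]
    rintro X ⟨hX, hX'⟩
    have h1 : X = -X := (show ⁅a₁ n, X⁆ = X from hX).symm.trans (hm X hX')
    have h2 : (2 : ℝ) • X = 0 := by rw [two_smul]; nth_rw 1 [h1]; exact neg_add_cancel X
    exact (smul_eq_zero.1 h2).resolve_left two_ne_zero
  have hfin : Module.finrank ℝ p = 2 * (n - 1) := by
    have := Submodule.finrank_sup_add_finrank_inf_eq (nSub n) ((nSub n).map (theta n))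
    rw [hdisj, finrank_bot, (Submodule.equivMapOfInjective _ hinj _).symm.finrank_eq, h] at this
    change Module.finrank ℝ p + 0 = _ at this
    omega
  have htr := hp.trace
  rw [hfin] at htr
  rw [innerProd, theta_a₁, form, map_neg,
    show killingForm ℝ (so n) (a₁ n) (a₁ n) = _ from htr]
  rw [Nat.cast_mul, Nat.cast_sub (by omega)]
  push_cast
  rw [neg_div, neg_neg, div_self]
  nlinarith

/-- The bracket has weight `0` and is negated by `θ`, so it is a multiple of `a₁`; pairing with the
unit vector `a₁` finds the multiple. -/
theorem lie_theta_of_innerProd {n : ℕ} [NeZero n] (ha : innerProd n (a₁ n) (a₁ n) = 1)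
    (X : nSub n) : ⁅(X : so n), theta n X⁆ = (-innerProd n X X) • a₁ n := by
  have hX : ⁅a₁ n, (X : so n)⁆ = X := X.2
  have h := eq_smul_a₁ (X := ⁅(X : so n), theta n X⁆)
    (by rw [theta_lie, theta_theta, lie_skew])
    (by rw [leibniz_lie, lie_a₁_theta, hX, lie_neg, add_neg_cancel])
  generalize ((⁅(X : so n), theta n X⁆ : so n) : Mat n) 0 (Fin.last n) = c at h
  have h1 := innerProd_lie_left (X : so n) (theta n X) (a₁ n)
  rw [h, innerProd_smul_left, ha, mul_one, ← lie_skew, lie_a₁_theta, hX, neg_neg,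
    innerProd_theta] at h1
  rw [h, h1]

/-! ### Sums over orthonormal families -/

theorem IsOrthonormal.eq_sum {n : ℕ} {ι : Type*} [Fintype ι] {b : ι → so n} (hb : IsOrthonormal b)
    {X : so n} (hX : X ∈ Submodule.span ℝ (Set.range b)) :
    X = ∑ i, innerProd n X (b i) • b i := by
  classical
  obtain ⟨c, rfl⟩ := (Submodule.mem_span_range_iff_exists_fun ℝ).1 hX
  refine Finset.sum_congr rfl fun i _ => ?_
  congr 1
  rw [← innerForm_apply, map_sum, LinearMap.sum_apply, Finset.sum_eq_single i]
  · rw [map_smul, LinearMap.smul_apply, innerForm_apply, hb.1 i, smul_eq_mul, mul_one]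
  · intro j _ hj
    rw [map_smul, LinearMap.smul_apply, innerForm_apply, hb.2 j i hj, smul_zero]
  · simp

/-- Expand the second argument in the other family, swap the sums, and use symmetry of the
coefficients to reassemble the first argument. -/
theorem IsOrthonormal.sum_eq_sum {n : ℕ} {ι κ V : Type*} [Fintype ι] [Fintype κ]
    [AddCommGroup V] [Module ℝ V] {b : ι → so n} {c : κ → so n} (hb : IsOrthonormal b)
    (hc : IsOrthonormal c) (hbc : ∀ i, b i ∈ Submodule.span ℝ (Set.range c))
    (hcb : ∀ j, c j ∈ Submodule.span ℝ (Set.range b)) (Q : so n →ₗ[ℝ] so n →ₗ[ℝ] V) :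
    ∑ i, Q (b i) (b i) = ∑ j, Q (c j) (c j) := by
  calc ∑ i, Q (b i) (b i) = ∑ i, ∑ j, innerProd n (b i) (c j) • Q (b i) (c j) := by
        refine Finset.sum_congr rfl fun i _ => ?_
        conv_lhs => arg 2; rw [hc.eq_sum (hbc i)]
        simp only [map_sum, map_smul]
    _ = ∑ j, ∑ i, innerProd n (c j) (b i) • Q (b i) (c j) := by
        rw [Finset.sum_comm]
        simp only [innerProd_comm]
    _ = ∑ j, Q (c j) (c j) := by
        refine Finset.sum_congr rfl fun j _ => ?_
        conv_rhs => arg 1; rw [hb.eq_sum (hcb j)]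
        simp only [map_sum, map_smul, LinearMap.sum_apply, LinearMap.smul_apply]

/-! ### The Casimir element in terms of `𝔞`, `𝔪` and `𝔫` -/

theorem lie_coe_nSub {n : ℕ} [NeZero n] (X : nSub n) : ⁅a₁ n, (X : so n)⁆ = (1 : ℝ) • (X : so n) := by
  rw [one_smul]
  exact X.2

theorem lie_theta_coe_nSub {n : ℕ} [NeZero n] (X : nSub n) :
    ⁅a₁ n, theta n X⁆ = (-1 : ℝ) • theta n X := by
  rw [lie_a₁_theta, lie_coe_nSub, one_smul, neg_one_smul]

theorem innerProd_coe_theta {n : ℕ} [NeZero n] (X Y : nSub n) :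
    innerProd n X (theta n Y) = 0 :=
  innerProd_eq_zero_of_lie_a₁ (lie_coe_nSub X) (lie_theta_coe_nSub Y) (by norm_num)

theorem innerProd_theta_coe {n : ℕ} [NeZero n] (X Y : nSub n) :
    innerProd n (theta n X) Y = 0 :=
  (innerProd_comm _ _).trans (innerProd_coe_theta Y X)

/-- The cross terms pair different eigenspaces of `ad a₁` and vanish; the other two contribute one
half each. -/
theorem innerProd_kVec {n : ℕ} [NeZero n] (X Y : nSub n) :
    innerProd n (kVec X) (kVec Y) = innerProd n X Y := by
  have h2 : (Real.sqrt 2)⁻¹ * (Real.sqrt 2)⁻¹ = 2⁻¹ := by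
    rw [← mul_inv, Real.mul_self_sqrt (by norm_num)]
  simp only [coe_kVec, innerProd_smul_left, innerProd_smul_right, innerProd_add_left,
    innerProd_add_right, innerProd_theta, innerProd_coe_theta, innerProd_theta_coe]
  linear_combination (2 * innerProd n X Y) * h2

theorem innerProd_pVec {n : ℕ} [NeZero n] (X Y : nSub n) :
    innerProd n (pVec X) (pVec Y) = innerProd n X Y := by
  have h2 : (Real.sqrt 2)⁻¹ * (Real.sqrt 2)⁻¹ = 2⁻¹ := by
    rw [← mul_inv, Real.mul_self_sqrt (by norm_num)]
  simp only [coe_pVec, sub_eq_add_neg, innerProd_smul_left, innerProd_smul_right,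
    innerProd_add_left, innerProd_add_right, innerProd_neg_left, innerProd_neg_right,
    innerProd_theta, innerProd_coe_theta, innerProd_theta_coe]
  linear_combination (2 * innerProd n X Y) * h2

/-- The part of `𝔤` commuting with `a₁` is orthogonal to `𝔫` and to `θ 𝔫`. -/
theorem innerProd_centralizer {n : ℕ} [NeZero n] (X : nSub n) {Z : so n} (hZ : ⁅a₁ n, Z⁆ = 0) :
    innerProd n X Z = 0 ∧ innerProd n (theta n X) Z = 0 := by
  have hZ' : ⁅a₁ n, Z⁆ = (0 : ℝ) • Z := by rw [hZ, zero_smul]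
  exact ⟨innerProd_eq_zero_of_lie_a₁ (lie_coe_nSub X) hZ' (by norm_num),
    innerProd_eq_zero_of_lie_a₁ (lie_theta_coe_nSub X) hZ' (by norm_num)⟩

theorem innerProd_kVec_centralizer {n : ℕ} [NeZero n] (X : nSub n) {Z : so n}
    (hZ : ⁅a₁ n, Z⁆ = 0) : innerProd n (kVec X) Z = 0 := by
  rw [coe_kVec, innerProd_smul_left, innerProd_add_left, (innerProd_centralizer X hZ).1,
    (innerProd_centralizer X hZ).2, add_zero, mul_zero]

theorem innerProd_pVec_centralizer {n : ℕ} [NeZero n] (X : nSub n) {Z : so n}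
    (hZ : ⁅a₁ n, Z⁆ = 0) : innerProd n (pVec X) Z = 0 := by
  rw [coe_pVec, innerProd_smul_left, sub_eq_add_neg, innerProd_add_left, innerProd_neg_left,
    (innerProd_centralizer X hZ).1, (innerProd_centralizer X hZ).2, neg_zero, add_zero, mul_zero]

theorem isOrthonormal_kVec_elim {n : ℕ} [NeZero n] {ι μ : Type*} {bn : ι → nSub n} {bm : μ → mAlg n}
    (hn : IsOrthonormal fun i => (bn i : so n)) (hm : IsOrthonormal fun j => (bm j : so n)) :
    IsOrthonormal (Sum.elim (fun i => (kVec (bn i) : so n)) fun j => (bm j : so n)) := by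
  constructor
  · rintro (i | j)
    · exact (innerProd_kVec _ _).trans (hn.1 i)
    · exact hm.1 j
  · rintro (i | i) (j | j) hij
    · exact (innerProd_kVec _ _).trans (hn.2 i j (by simpa using hij))
    · exact innerProd_kVec_centralizer _ (bm j).2.2
    · exact (innerProd_comm _ _).trans (innerProd_kVec_centralizer _ (bm i).2.2)
    · exact hm.2 i j (by simpa using hij)

theorem isOrthonormal_pVec_elim {n : ℕ} [NeZero n] {ι : Type*} {bn : ι → nSub n}
    (hn : IsOrthonormal fun i => (bn i : so n)) (ha : innerProd n (a₁ n) (a₁ n) = 1) :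
    IsOrthonormal (Sum.elim (fun i => (pVec (bn i) : so n)) fun _ : Unit => a₁ n) := by
  constructor
  · rintro (i | j)
    · exact (innerProd_pVec _ _).trans (hn.1 i)
    · exact ha
  · rintro (i | i) (j | j) hij
    · exact (innerProd_pVec _ _).trans (hn.2 i j (by simpa using hij))
    · exact innerProd_pVec_centralizer _ (lie_self _)
    · exact (innerProd_comm _ _).trans (innerProd_pVec_centralizer _ (lie_self _))
    · simp at hij

/-! ### Spanning by the adapted families, and the change of basis in the Casimir sum -/

theorem kVec_add {n : ℕ} [NeZero n] (X Y : nSub n) :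
    (kVec (X + Y) : so n) = kVec X + (kVec Y : so n) := by
  simp only [coe_kVec, Submodule.coe_add, map_add]
  module

theorem kVec_smul {n : ℕ} [NeZero n] (c : ℝ) (X : nSub n) :
    (kVec (c • X) : so n) = c • (kVec X : so n) := by
  simp only [coe_kVec, Submodule.coe_smul, map_smul]
  module

theorem pVec_add {n : ℕ} [NeZero n] (X Y : nSub n) :
    (pVec (X + Y) : so n) = pVec X + (pVec Y : so n) := by
  simp only [coe_pVec, Submodule.coe_add, map_add]
  module

theorem pVec_smul {n : ℕ} [NeZero n] (c : ℝ) (X : nSub n) :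
    (pVec (c • X) : so n) = c • (pVec X : so n) := by
  simp only [coe_pVec, Submodule.coe_smul, map_smul]
  module

/-- The span of the image of a basis under a linear map contains the image of every vector. -/
theorem map_mem_span_range {ι V W : Type*} [Fintype ι] [AddCommGroup V] [Module ℝ V]
    [AddCommGroup W] [Module ℝ W] (b : Module.Basis ι ℝ V) (φ : V →ₗ[ℝ] W) (v : V) :
    φ v ∈ Submodule.span ℝ (Set.range fun i => φ (b i)) := by
  rw [← b.sum_repr v, map_sum]
  refine Submodule.sum_mem _ fun i _ => ?_
  rw [map_smul]
  exact Submodule.smul_mem _ _ (Submodule.subset_span ⟨i, rfl⟩)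

theorem kAlg_le_span {n : ℕ} [NeZero n] {ι μ : Type*} [Fintype ι] [Fintype μ]
    (bn : Module.Basis ι ℝ (nSub n)) (bm : Module.Basis μ ℝ (mAlg n)) {X : so n}
    (hX : X ∈ kAlg n) : X ∈ Submodule.span ℝ
      (Set.range (Sum.elim (fun i => (kVec (bn i) : so n)) fun j => (bm j : so n))) := by
  obtain ⟨Y, Z, rfl⟩ := exists_kAlg_decomposition hX
  rw [Set.Sum.elim_range, Submodule.span_union]
  exact Submodule.add_mem_sup
    (map_mem_span_range bn ⟨⟨fun Y => (kVec Y : so n), kVec_add⟩, kVec_smul⟩ Y)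
    (map_mem_span_range bm (mAlg n).toSubmodule.subtype Z)

theorem pSub_le_span {n : ℕ} [NeZero n] {ι : Type*} [Fintype ι]
    (bn : Module.Basis ι ℝ (nSub n)) {X : so n}
    (hX : X ∈ pSub n) : X ∈ Submodule.span ℝ
      (Set.range (Sum.elim (fun i => (pVec (bn i) : so n)) fun _ : Unit => a₁ n)) := by
  obtain ⟨Y, c, rfl⟩ := exists_pSub_decomposition hX
  rw [Set.Sum.elim_range, Submodule.span_union]
  exact Submodule.add_mem_sup
    (map_mem_span_range bn ⟨⟨fun Y => (pVec Y : so n), pVec_add⟩, pVec_smul⟩ Y)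
    (Submodule.smul_mem _ _ (Submodule.subset_span ⟨(), rfl⟩))

theorem IsOrthonormal.map {n : ℕ} {ι : Type*} {b : ι → so n} (hb : IsOrthonormal b)
    (e : so n ≃ₗ⁅ℝ⁆ so n) (he : ∀ X, e (theta n X) = theta n (e X)) :
    IsOrthonormal fun i => e (b i) :=
  ⟨fun i => (innerProd_equiv e he _ _).trans (hb.1 i),
    fun i j hij => (innerProd_equiv e he _ _).trans (hb.2 i j hij)⟩

/-- The Casimir element, evaluated on a bilinear map `Q` on `𝔤` whose antisymmetric part factors
through the bracket. -/
theorem casimir_sum_eq {n : ℕ} [NeZero n] (hn : 2 ≤ n)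
    {ι κ μ V : Type*} [Fintype ι] [Fintype κ] [Fintype μ] [AddCommGroup V] [Module ℝ V]
    (bk : Module.Basis ι ℝ (kAlg n)) (hbk : IsOrthonormal fun i => (bk i : so n))
    (bp : Module.Basis κ ℝ (pSub n)) (hbp : IsOrthonormal fun j => (bp j : so n))
    (bm : Module.Basis μ ℝ (mAlg n)) (hbm : IsOrthonormal fun j => (bm j : so n))
    (bn : Module.Basis (Fin (n - 1)) ℝ (nSub n)) (hbn : IsOrthonormal fun i => (bn i : so n))
    (e : so n ≃ₗ⁅ℝ⁆ so n) (he : ∀ X, e (theta n X) = theta n (e X))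
    (Q : so n →ₗ[ℝ] so n →ₗ[ℝ] V) (D : so n →ₗ[ℝ] V) (hQ : ∀ X Y, Q X Y - Q Y X = D ⁅X, Y⁆) :
    -∑ i, Q (e (bk i)) (e (bk i)) + ∑ j, Q (e (bp j)) (e (bp j))
      = Q (a₁ n) (a₁ n) + ((n : ℝ) - 1) • D (a₁ n)
        + ∑ i, ((2 : ℝ) • Q (bn i) (bn i)
          - (2 * Real.sqrt 2) • Q (kVec (bn i) : so n) (bn i))
        - ∑ j, Q (bm j) (bm j) := by
  have ha : innerProd n (a₁ n) (a₁ n) = 1 :=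
    innerProd_a₁ hn ((Module.finrank_eq_card_basis bn).trans (Fintype.card_fin _))
  have he' : ∀ X, e.symm (theta n X) = theta n (e.symm X) := fun X => by
    rw [e.symm_apply_eq, he, e.apply_symm_apply]
  have hk : ∑ i, Q (e (bk i)) (e (bk i))
      = ∑ i, Q (kVec (bn i) : so n) (kVec (bn i) : so n) + ∑ j, Q (bm j) (bm j) := by
    rw [(hbk.map e he).sum_eq_sum (isOrthonormal_kVec_elim hbn hbm) _ _ Q, Fintype.sum_sum_type]
    · rfl
    · intro i
      refine kAlg_le_span bn bm ?_
      change theta n _ = _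
      rw [← he]
      exact congrArg e (bk i).2
    · intro j
      set c := Sum.elim (fun i => (kVec (bn i) : so n)) (fun j => (bm j : so n)) j with hc
      have hmem : theta n c = c := by
        rw [hc]
        cases j with
        | inl i => exact (kVec (bn i)).2
        | inr j => exact (bm j).2.1
      -- Since `e` commutes with `θ` it maps `𝔨` onto itself, so `c` is the image of `e.symm c ∈ 𝔨`.
      have := map_mem_span_range bk ((e : so n →ₗ[ℝ] so n) ∘ₗ (kAlg n).toSubmodule.subtype)
        ⟨e.symm c, (he' c).symm.trans (congrArg _ hmem)⟩
      rw [← e.apply_symm_apply c]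
      exact this
  have hp : ∑ i, Q (e (bp i)) (e (bp i))
      = ∑ i, Q (pVec (bn i) : so n) (pVec (bn i) : so n) + Q (a₁ n) (a₁ n) := by
    rw [(hbp.map e he).sum_eq_sum (isOrthonormal_pVec_elim hbn ha) _ _ Q, Fintype.sum_sum_type]
    · simp
    · intro i
      refine pSub_le_span bn ?_
      change theta n _ = _
      rw [← he, ← map_neg]
      exact congrArg e (bp i).2
    · intro j
      set c := Sum.elim (fun i => (pVec (bn i) : so n)) (fun _ : Unit => a₁ n) j with hc
      have hmem : theta n c = -c := by
        rw [hc]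
        cases j with
        | inl i => exact (pVec (bn i)).2
        | inr j => exact theta_a₁ n
      have := map_mem_span_range bp ((e : so n →ₗ[ℝ] so n) ∘ₗ (pSub n).subtype)
        ⟨e.symm c, (he' c).symm.trans ((congrArg _ hmem).trans (map_neg _ _))⟩
      simpa using this
  -- Square `p = √2 n - k` and move `k` to the left of `n`; each reordering costs a bracket worth
  -- one `D (a₁ n)`. After summation the `k` squares cancel those from `𝔨`.
  have hterm : ∀ i, Q (pVec (bn i) : so n) (pVec (bn i) : so n)
      = Q (kVec (bn i) : so n) (kVec (bn i) : so n)
        + ((2 : ℝ) • Q (bn i) (bn i) - (2 * Real.sqrt 2) • Q (kVec (bn i) : so n) (bn i))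
        + D (a₁ n) := by
    intro i
    have h2 : Real.sqrt 2 * Real.sqrt 2 = 2 := Real.mul_self_sqrt (by norm_num)
    have h1 : (pVec (bn i) : so n) = Real.sqrt 2 • (bn i : so n) - kVec (bn i) := by
      rw [coe_pVec, coe_kVec]
      have : Real.sqrt 2 = 2 * (Real.sqrt 2)⁻¹ := by field_simp; linarith
      conv_rhs => arg 1; rw [this]
      module
    have h3 : Q (bn i) (kVec (bn i) : so n)
        = Q (kVec (bn i) : so n) (bn i) - (Real.sqrt 2)⁻¹ • D (a₁ n) := by
      have h := hQ (bn i) (kVec (bn i) : so n)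
      rw [sub_eq_iff_eq_add] at h
      rw [h, add_comm, sub_eq_add_neg]
      congr 1
      rw [coe_kVec, lie_smul, lie_add, lie_self, zero_add,
        lie_theta_of_innerProd ha, hbn.1 i, neg_one_smul, smul_neg, map_neg, map_smul]
    have h4 : Real.sqrt 2 * (Real.sqrt 2)⁻¹ = 1 := mul_inv_cancel₀ (by positivity)
    rw [h1]
    simp only [map_sub, map_smul, LinearMap.sub_apply, LinearMap.smul_apply, h3]
    simp only [smul_sub, smul_smul, h2, h4]
    module
  rw [hk, hp]
  simp only [hterm, Finset.sum_add_distrib, Finset.sum_const, Finset.card_univ, Fintype.card_fin]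
  rw [← Nat.cast_smul_eq_nsmul ℝ, Nat.cast_sub (by omega), Nat.cast_one]
  abel

/-! ### The adjoint action -/

theorem mat_ext {n : ℕ} {g h : G n} (H : mat g = mat h) : g = h :=
  Subtype.ext (Units.ext H)

theorem mat_inv_mul {n : ℕ} (g : G n) : mat g⁻¹ * mat g = 1 := by
  rw [← mat_mul, inv_mul_cancel]
  rfl

theorem mat_mul_inv {n : ℕ} (g : G n) : mat g * mat g⁻¹ = 1 := by
  rw [← mat_mul, mul_inv_cancel]
  rfl

theorem mat_transpose_mul_J_mul {n : ℕ} (g : G n) : (mat g)ᵀ * J n * mat g = J n := by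
  obtain ⟨h, -, hh⟩ := g.2
  have := h.2.1
  change ((g : GL (Fin (n + 1)) ℝ) : Mat n)ᵀ * J n * ((g : GL (Fin (n + 1)) ℝ) : Mat n) = J n
  rw [← hh]
  exact this

theorem mat_transpose_mul_J {n : ℕ} (g : G n) : (mat g)ᵀ * J n = J n * mat g⁻¹ := by
  have h := congrArg (· * mat g⁻¹) (mat_transpose_mul_J_mul g)
  simpa only [Matrix.mul_assoc, mat_mul_inv, Matrix.mul_one] using h

/-- `Ad g X = g X g⁻¹`. -/
def adFun {n : ℕ} (g : G n) (X : so n) : so n :=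
  ⟨mat g * X * mat g⁻¹, by
    refine ⟨?_, ?_⟩
    · have h1 := mat_transpose_mul_J g
      have h2 := mat_transpose_mul_J g⁻¹
      rw [inv_inv] at h2
      have hX : (X : Mat n)ᵀ * J n = -(J n * X) := eq_neg_of_add_eq_zero_left X.2.1
      calc (mat g * (X : Mat n) * mat g⁻¹)ᵀ * J n + J n * (mat g * (X : Mat n) * mat g⁻¹)
          = (mat g⁻¹)ᵀ * ((X : Mat n)ᵀ * ((mat g)ᵀ * J n)) + J n * mat g * (X : Mat n) * mat g⁻¹ := by
            simp only [Matrix.transpose_mul, Matrix.mul_assoc]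
        _ = (mat g⁻¹)ᵀ * ((X : Mat n)ᵀ * J n) * mat g⁻¹ + J n * mat g * (X : Mat n) * mat g⁻¹ := by
            rw [h1]; simp only [Matrix.mul_assoc]
        _ = -((mat g⁻¹)ᵀ * J n) * (X : Mat n) * mat g⁻¹ + J n * mat g * (X : Mat n) * mat g⁻¹ := by
            rw [hX]; simp only [Matrix.mul_assoc, Matrix.mul_neg, Matrix.neg_mul]
        _ = 0 := by rw [h2]; simp only [Matrix.neg_mul, neg_add_cancel]
    · rw [Matrix.trace_mul_cycle, mat_inv_mul, Matrix.one_mul]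
      exact X.2.2⟩

/-- The adjoint action of `G` on `𝔤`. -/
def Ad {n : ℕ} (g : G n) : so n ≃ₗ⁅ℝ⁆ so n where
  toFun := adFun g
  invFun := adFun g⁻¹
  map_add' X Y := by
    ext1
    change mat g * ((X : Mat n) + Y) * mat g⁻¹ = mat g * X * mat g⁻¹ + mat g * Y * mat g⁻¹
    rw [Matrix.mul_add, Matrix.add_mul]
  map_smul' c X := by
    ext1
    change mat g * (c • (X : Mat n)) * mat g⁻¹ = c • (mat g * X * mat g⁻¹)
    rw [Matrix.mul_smul, Matrix.smul_mul]
  map_lie' := by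
    intro X Y
    ext1
    change mat g * ((X : Mat n) * Y - (Y : Mat n) * X) * mat g⁻¹
      = (mat g * X * mat g⁻¹) * (mat g * Y * mat g⁻¹)
        - (mat g * Y * mat g⁻¹) * (mat g * X * mat g⁻¹)
    have h : ∀ A B : Mat n, mat g * A * mat g⁻¹ * (mat g * B * mat g⁻¹)
        = mat g * (A * B) * mat g⁻¹ := by
      intro A B
      calc mat g * A * mat g⁻¹ * (mat g * B * mat g⁻¹)
          = mat g * A * (mat g⁻¹ * mat g) * B * mat g⁻¹ := by simp only [Matrix.mul_assoc]
        _ = mat g * (A * B) * mat g⁻¹ := by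
          rw [mat_inv_mul, Matrix.mul_one, Matrix.mul_assoc (mat g)]
    rw [h, h, Matrix.mul_sub, Matrix.sub_mul]
  left_inv X := by
    ext1
    change mat g⁻¹ * (mat g * X * mat g⁻¹) * mat g⁻¹⁻¹ = X
    rw [inv_inv, ← Matrix.mul_assoc, ← Matrix.mul_assoc, mat_inv_mul, Matrix.one_mul,
      Matrix.mul_assoc, mat_inv_mul, Matrix.mul_one]
  right_inv X := by
    ext1
    change mat g * (mat g⁻¹ * X * mat g⁻¹⁻¹) * mat g⁻¹ = X
    rw [inv_inv, ← Matrix.mul_assoc, ← Matrix.mul_assoc, mat_mul_inv, Matrix.one_mul,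
      Matrix.mul_assoc, mat_mul_inv, Matrix.mul_one]

theorem coe_Ad {n : ℕ} (g : G n) (X : so n) : (Ad g X : Mat n) = mat g * X * mat g⁻¹ := rfl

theorem mat_inv_of_mem_KGroup {n : ℕ} {k : G n} (hk : k ∈ KGroup n) : mat k⁻¹ = (mat k)ᵀ := by
  have hk' : (mat k)ᵀ * mat k = 1 := hk
  have h := congrArg (· * mat k⁻¹) hk'
  simpa only [Matrix.mul_assoc, mat_mul_inv, Matrix.mul_one, Matrix.one_mul] using h.symm

/-- On `K` the inverse is the transpose, so conjugation by `k` commutes with transposition. -/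
theorem Ad_theta {n : ℕ} {k : G n} (hk : k ∈ KGroup n) (X : so n) :
    Ad k (theta n X) = theta n (Ad k X) := by
  ext1
  rw [coe_Ad, theta_coe, theta_coe, coe_Ad, mat_inv_of_mem_KGroup hk]
  simp only [Matrix.transpose_mul, Matrix.transpose_transpose, Matrix.mul_neg, Matrix.neg_mul,
    Matrix.mul_assoc]

theorem inv_mem_KGroup {n : ℕ} {k : G n} (hk : k ∈ KGroup n) : k⁻¹ ∈ KGroup n := by
  change (mat k⁻¹)ᵀ * mat k⁻¹ = 1
  rw [mat_inv_of_mem_KGroup hk, Matrix.transpose_transpose, ← mat_inv_of_mem_KGroup hk,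
    mat_mul_inv]

theorem mul_mem_KGroup {n : ℕ} {k l : G n} (hk : k ∈ KGroup n) (hl : l ∈ KGroup n) :
    k * l ∈ KGroup n := by
  have hk' : (mat k)ᵀ * mat k = 1 := hk
  have hl' : (mat l)ᵀ * mat l = 1 := hl
  change (mat (k * l))ᵀ * mat (k * l) = 1
  rw [mat_mul, Matrix.transpose_mul, Matrix.mul_assoc, ← Matrix.mul_assoc _ (mat k), hk',
    Matrix.one_mul, hl']

/-! ### The exponential map -/

section Exp

attribute [local instance] Matrix.linftyOpNormedAddCommGroup Matrix.linftyOpNormedSpace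
  Matrix.linftyOpNormedRing Matrix.linftyOpNormedAlgebra

theorem mul_expG_of_semiconjBy {n : ℕ} {g : G n} {X Y : so n}
    (h : mat g * (X : Mat n) = (Y : Mat n) * mat g) : g * expG X = expG Y * g :=
  mat_ext (SemiconjBy.exp_right (x := mat g) (a := (X : Mat n)) (b := (Y : Mat n)) h)

theorem expG_add {n : ℕ} {X Y : so n} (h : ⁅X, Y⁆ = 0) : expG (X + Y) = expG X * expG Y := by
  refine mat_ext ?_
  rw [mat_mul, mat_expG, mat_expG, mat_expG]
  exact Matrix.exp_add_of_commute _ _ (sub_eq_zero.1 (congrArg Subtype.val h))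

theorem expG_zero {n : ℕ} : expG (0 : so n) = 1 :=
  mat_ext (NormedSpace.exp_zero (𝔸 := Mat n))

theorem exp_add_smul_one {m : Type*} [Fintype m] [DecidableEq m] (A : Matrix m m ℝ) (c : ℝ) :
    NormedSpace.exp (A + c • 1) = Real.exp c • NormedSpace.exp A := by
  have h : NormedSpace.exp (c • (1 : Matrix m m ℝ)) = Real.exp c • 1 := by
    rw [← Algebra.algebraMap_eq_smul_one, ← Algebra.algebraMap_eq_smul_one, Real.exp_eq_exp_ℝ]
    exact (NormedSpace.algebraMap_exp_comm (𝔸 := Matrix m m ℝ) c).symm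
  rw [Matrix.exp_add_of_commute _ _ ((Commute.one_right A).smul_right c), h, Matrix.mul_smul,
    Matrix.mul_one]

/-- The relation `[a₁,X] = X` says that `X` intertwines `a₁ + 1` with `a₁`; scaling by `t` and
exponentiating produces the factor `e^t`. -/
theorem expG_a₁_mul {n : ℕ} [NeZero n] (t : ℝ) (X : nSub n) :
    mat (expG (t • a₁ n)) * ((X : so n) : Mat n)
      = Real.exp t • (((X : so n) : Mat n) * mat (expG (t • a₁ n))) := by
  have hX : (a₁ n : Mat n) * ((X : so n) : Mat n) - ((X : so n) : Mat n) * a₁ n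
      = ((X : so n) : Mat n) := congrArg Subtype.val (X.2 : ⁅a₁ n, (X : so n)⁆ = X)
  have h : SemiconjBy ((X : so n) : Mat n) (t • (a₁ n : Mat n) + t • 1) (t • (a₁ n : Mat n)) := by
    change _ * _ = _ * _
    rw [← smul_add, Matrix.mul_smul, Matrix.smul_mul, mul_add, mul_one]
    congr 1
    nth_rw 2 [← hX]
    abel
  exact (SemiconjBy.eq h.exp_right).symm.trans
    ((congrArg (((X : so n) : Mat n) * ·) (exp_add_smul_one (t • (a₁ n : Mat n)) t)).trans
      (Matrix.mul_smul _ _ _))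

theorem expG_a₁_mul_expG {n : ℕ} [NeZero n] (t : ℝ) (X : nSub n) :
    expG (t • a₁ n) * expG (X : so n) = expG (Real.exp t • (X : so n)) * expG (t • a₁ n) := by
  refine mul_expG_of_semiconjBy ?_
  rw [expG_a₁_mul]
  exact (Matrix.smul_mul _ _ _).symm

theorem mul_expG_eq_expG_Ad_mul {n : ℕ} (g : G n) (X : so n) :
    g * expG X = expG (Ad g X) * g := by
  refine mul_expG_of_semiconjBy ?_
  rw [coe_Ad, Matrix.mul_assoc _ _ (mat g), mat_inv_mul, Matrix.mul_one]

theorem expG_mem_KGroup {n : ℕ} (x : kAlg n) : expG (x : so n) ∈ KGroup n := by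
  have hx : (((x : so n) : Mat n))ᵀ = -((x : so n) : Mat n) := by
    have h := congrArg Subtype.val (x.2 : theta n (x : so n) = x)
    rw [theta_coe] at h
    exact neg_eq_iff_eq_neg.1 h
  change (mat _)ᵀ * mat _ = 1
  rw [mat_expG, ← Matrix.exp_transpose, hx,
    ← Matrix.exp_add_of_commute _ _ (Commute.refl ((x : so n) : Mat n)).neg_left, neg_add_cancel,
    NormedSpace.exp_zero]

end Exp

/-! ### Matrix exponentials applied to vectors -/

section ExpMulVec

attribute [local instance] Matrix.linftyOpNormedAddCommGroup Matrix.linftyOpNormedSpace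
  Matrix.linftyOpNormedRing Matrix.linftyOpNormedAlgebra

theorem hasSum_exp_mulVec {m : Type*} [Fintype m] [DecidableEq m] (M : Matrix m m ℝ) (v : m → ℝ) :
    HasSum (fun k : ℕ => ((k.factorial : ℝ)⁻¹ • M ^ k) *ᵥ v) (NormedSpace.exp M *ᵥ v) := by
  let φ : Matrix m m ℝ →+ (m → ℝ) :=
    { toFun := fun A => A *ᵥ v
      map_zero' := Matrix.zero_mulVec v
      map_add' := fun A B => Matrix.add_mulVec A B v }
  have hφ : Continuous φ := Continuous.matrix_mulVec continuous_id continuous_const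
  exact (NormedSpace.exp_series_hasSum_exp' (𝕂 := ℝ) M).map φ hφ

theorem exp_mulVec_of_eigenvector {m : Type*} [Fintype m] [DecidableEq m] {M : Matrix m m ℝ}
    {v : m → ℝ} {c : ℝ} (h : M *ᵥ v = c • v) : NormedSpace.exp M *ᵥ v = Real.exp c • v := by
  refine (hasSum_exp_mulVec M v).unique ?_
  have hk : ∀ k : ℕ, M ^ k *ᵥ v = c ^ k • v := by
    intro k
    induction k with
    | zero => simp
    | succ k ih =>
      rw [pow_succ', ← Matrix.mulVec_mulVec, ih, Matrix.mulVec_smul, h, smul_smul, pow_succ]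
  have hs := (NormedSpace.exp_series_hasSum_exp' (𝕂 := ℝ) c).smul_const v
  rw [← Real.exp_eq_exp_ℝ] at hs
  convert hs using 2 with k
  rw [Matrix.smul_mulVec, hk, smul_eq_mul, smul_smul]

/-- The exponential series stops after the quadratic term; nilpotency is needed only on the vector
`v`. -/
theorem exp_mulVec_of_cube {m : Type*} [Fintype m] [DecidableEq m] {M : Matrix m m ℝ}
    {v : m → ℝ} (h : M *ᵥ M *ᵥ M *ᵥ v = 0) :
    NormedSpace.exp M *ᵥ v = v + M *ᵥ v + (2 : ℝ)⁻¹ • M *ᵥ M *ᵥ v := by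
  refine (hasSum_exp_mulVec M v).unique ?_
  have hk : ∀ k : ℕ, k ∉ Finset.range 3 → ((k.factorial : ℝ)⁻¹ • M ^ k) *ᵥ v = 0 := by
    intro k hk
    obtain ⟨j, rfl⟩ := Nat.exists_eq_add_of_le (not_lt.1 fun h => hk (Finset.mem_range.2 h))
    rw [Matrix.smul_mulVec, add_comm, pow_add, pow_succ, pow_two, ← Matrix.mulVec_mulVec,
      ← Matrix.mulVec_mulVec, ← Matrix.mulVec_mulVec, h, Matrix.mulVec_zero, smul_zero]
  have hs : HasSum _ _ _ := hasSum_sum_of_ne_finset_zero (L := .unconditional ℕ) hk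
  convert hs using 1
  simp [Finset.sum_range_succ, pow_two, Matrix.smul_mulVec, Nat.factorial]

end ExpMulVec

/-! ### Column vectors -/

/-- The time-like basis vector. -/
def eLast (n : ℕ) : Fin (n + 1) → ℝ := Pi.single (Fin.last n) 1

/-- The basis vector in the direction `0`. -/
def eZero (n : ℕ) : Fin (n + 1) → ℝ := Pi.single 0 1

theorem mulVec_eLast {n : ℕ} (M : Mat n) : M *ᵥ eLast n = fun i => M i (Fin.last n) := by
  simp [eLast, Matrix.col_def, funext_iff]

theorem mulVec_eZero {n : ℕ} (M : Mat n) : M *ᵥ eZero n = fun i => M i 0 := by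
  simp [eZero, Matrix.col_def, funext_iff]

theorem a₁_mulVec {n : ℕ} [NeZero n] :
    (a₁ n : Mat n) *ᵥ eLast n = eZero n ∧ (a₁ n : Mat n) *ᵥ eZero n = eLast n := by
  have h := @zero_ne_last n _
  constructor
  · rw [mulVec_eLast]
    ext i
    by_cases hi : i = 0
    · simp [coe_a₁, eZero, hi, h]
    · simp [coe_a₁, eZero, hi, h, Ne.symm hi]
  · rw [mulVec_eZero]
    ext i
    by_cases hi : i = Fin.last n
    · simp [coe_a₁, eLast, hi, h.symm]
    · simp [coe_a₁, eLast, hi, h.symm, Ne.symm hi]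

/-- The time-like vector is a combination of the null vectors `e₀ ± e_last`, which are eigenvectors
of `a₁` for `±1`. -/
theorem expG_a₁_mulVec {n : ℕ} [NeZero n] (t : ℝ) :
    mat (expG (t • a₁ n)) *ᵥ eLast n
      = (Real.exp t / 2) • (eZero n + eLast n) - (Real.exp (-t) / 2) • (eZero n - eLast n) := by
  obtain ⟨h1, h2⟩ := a₁_mulVec (n := n)
  have hp : (t • (a₁ n : Mat n)) *ᵥ (eZero n + eLast n) = t • (eZero n + eLast n) := by
    rw [Matrix.smul_mulVec, Matrix.mulVec_add, h1, h2, add_comm (eLast n)]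
  have hm : (t • (a₁ n : Mat n)) *ᵥ (eZero n - eLast n) = (-t) • (eZero n - eLast n) := by
    rw [Matrix.smul_mulVec, Matrix.mulVec_sub, h1, h2]
    module
  have h : eLast n = (2 : ℝ)⁻¹ • (eZero n + eLast n) - (2 : ℝ)⁻¹ • (eZero n - eLast n) := by module
  conv_lhs => rw [h]
  rw [Matrix.mulVec_sub, Matrix.mulVec_smul, Matrix.mulVec_smul]
  change _ • (NormedSpace.exp (t • (a₁ n : Mat n)) *ᵥ _)
    - _ • (NormedSpace.exp (t • (a₁ n : Mat n)) *ᵥ _) = _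
  rw [exp_mulVec_of_eigenvector hp, exp_mulVec_of_eigenvector hm]
  module

/-! ### Coordinates on `𝔫` -/

theorem a₁_commutator_apply {n : ℕ} [NeZero n] (M : Mat n) (i j : Fin (n + 1)) :
    ((a₁ n : Mat n) * M - M * (a₁ n : Mat n)) i j
      = ((if i = 0 then M (Fin.last n) j else 0) + (if i = Fin.last n then M 0 j else 0))
        - ((if j = Fin.last n then M i 0 else 0) + (if j = 0 then M i (Fin.last n) else 0)) := by
  rw [Matrix.sub_apply, coe_a₁, add_mul, mul_add, Matrix.add_apply, Matrix.add_apply]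
  congr 2
  all_goals
    simp [Matrix.mul_apply, Matrix.single_apply, eq_comm, ite_and]

theorem nSub_apply {n : ℕ} [NeZero n] (X : nSub n) (i j : Fin (n + 1)) :
    ((if i = 0 then ((X : so n) : Mat n) (Fin.last n) j else 0)
        + (if i = Fin.last n then ((X : so n) : Mat n) 0 j else 0))
      - ((if j = Fin.last n then ((X : so n) : Mat n) i 0 else 0)
        + (if j = 0 then ((X : so n) : Mat n) i (Fin.last n) else 0))
      = ((X : so n) : Mat n) i j :=
  (a₁_commutator_apply _ i j).symm.trans
    (congrFun (congrFun (congrArg Subtype.val (X.2 : ⁅a₁ n, (X : so n)⁆ = X)) i) j)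

theorem nSub_zero_last {n : ℕ} [NeZero n] (X : nSub n) :
    ((X : so n) : Mat n) 0 (Fin.last n) = 0 := by
  have h := nSub_apply X 0 (Fin.last n)
  have h0 := @zero_ne_last n _
  simp only [so_diag, h0, h0.symm, if_true, if_false] at h
  linarith

theorem nSub_col_zero {n : ℕ} [NeZero n] (X : nSub n) (i : Fin (n + 1)) :
    ((X : so n) : Mat n) i 0 = -((X : so n) : Mat n) i (Fin.last n) := by
  have h0 := @zero_ne_last n _
  by_cases hi : i = 0
  · rw [hi, so_diag, nSub_zero_last, neg_zero]
  by_cases hi' : i = Fin.last n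
  · rw [hi', so_diag, so_last, nSub_zero_last, neg_zero]
  have h := nSub_apply X i 0
  simp only [hi, hi', h0, if_true, if_false] at h
  linarith

theorem nSub_row_zero {n : ℕ} [NeZero n] (X : nSub n) (j : Fin (n + 1)) :
    ((X : so n) : Mat n) 0 j = ((X : so n) : Mat n) j (Fin.last n) := by
  have h0 := @zero_ne_last n _
  by_cases hj : j = Fin.last n
  · rw [hj, so_diag, nSub_zero_last]
  · rw [so_skew _ h0 hj, nSub_col_zero, neg_neg]

theorem nSub_middle {n : ℕ} [NeZero n] (X : nSub n) {i j : Fin (n + 1)} (hi : i ≠ 0)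
    (hi' : i ≠ Fin.last n) (hj : j ≠ 0) (hj' : j ≠ Fin.last n) :
    ((X : so n) : Mat n) i j = 0 := by
  have h := nSub_apply X i j
  simp only [hi, hi', hj, hj', if_false] at h
  linarith

/-- The eigenvalue equation recovers every entry from the middle of the last column, which thus
gives coordinates on `𝔫`. -/
theorem nSub_ext {n : ℕ} [NeZero n] {X Y : nSub n}
    (h : ∀ i, i ≠ 0 → i ≠ Fin.last n →
      ((X : so n) : Mat n) i (Fin.last n) = ((Y : so n) : Mat n) i (Fin.last n)) : X = Y := by
  have hcol : ∀ i, ((X : so n) : Mat n) i (Fin.last n) = ((Y : so n) : Mat n) i (Fin.last n) := by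
    intro i
    by_cases hi : i = 0
    · rw [hi, nSub_zero_last, nSub_zero_last]
    by_cases hi' : i = Fin.last n
    · rw [hi', so_diag, so_diag]
    exact h i hi hi'
  ext i j
  by_cases hi : i = 0
  · rw [hi, nSub_row_zero, nSub_row_zero, hcol]
  by_cases hi' : i = Fin.last n
  · rw [hi', so_last, so_last, hcol]
  by_cases hj : j = 0
  · rw [hj, nSub_col_zero, nSub_col_zero, hcol]
  by_cases hj' : j = Fin.last n
  · rw [hj', hcol]
  rw [nSub_middle X hi hi' hj hj', nSub_middle Y hi hi' hj hj']

theorem nSub_mulVec_add {n : ℕ} [NeZero n] (X : nSub n) :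
    ((X : so n) : Mat n) *ᵥ (eZero n + eLast n) = 0 := by
  rw [Matrix.mulVec_add, mulVec_eLast, mulVec_eZero]
  ext i
  simp [nSub_col_zero]

/-- Since `𝔫` kills the null vector `e₀ + e_last`, it follows that `X³ e_last = 0`, so `exp X` is
quadratic in `X` there. -/
theorem nSub_mulVec_eLast {n : ℕ} [NeZero n] (X : nSub n) :
    ((X : so n) : Mat n) *ᵥ (((X : so n) : Mat n) *ᵥ eLast n)
      = (∑ j, ((X : so n) : Mat n) j (Fin.last n) ^ 2) • (eZero n + eLast n) := by
  rw [mulVec_eLast]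
  ext i
  simp only [Matrix.mulVec, dotProduct, Pi.smul_apply, Pi.add_apply, smul_eq_mul]
  by_cases hi : i = 0
  · have : eZero n i + eLast n i = 1 := by
      have z := @zero_ne_last n _
      simp [hi, eZero, eLast, z]
    rw [this, mul_one, hi]
    exact Finset.sum_congr rfl fun j _ => by rw [nSub_row_zero, pow_two]
  by_cases hi' : i = Fin.last n
  · have : eZero n i + eLast n i = 1 := by simp [hi', eZero, eLast, NeZero.ne n]
    rw [this, mul_one, hi']
    exact Finset.sum_congr rfl fun j _ => by rw [so_last, pow_two]
  · have : eZero n i + eLast n i = 0 := by simp [hi, hi', eZero, eLast]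
    rw [this, mul_zero]
    refine Finset.sum_eq_zero fun j _ => ?_
    by_cases hj : j = 0
    · rw [hj, nSub_zero_last, mul_zero]
    by_cases hj' : j = Fin.last n
    · rw [hj', so_diag, mul_zero]
    rw [nSub_middle X hi hi' hj hj', zero_mul]

/-- The element of `𝔫` with the given last column. -/
def ofCol {n : ℕ} [NeZero n] (c : Fin (n + 1) → ℝ) (h0 : c 0 = 0) (hl : c (Fin.last n) = 0) :
    nSub n :=
  ⟨⟨Matrix.of fun i j => c i * (eLast n j - eZero n j) + (eZero n i + eLast n i) * c j, by
    have hz := @zero_ne_last n _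
    refine ⟨?_, ?_⟩
    · ext i j
      simp only [J, Matrix.add_apply, Matrix.mul_diagonal, Matrix.diagonal_mul,
        Matrix.transpose_apply, Matrix.of_apply, Matrix.zero_apply, eLast, eZero, Pi.single_apply]
      by_cases hi : i = 0 <;> by_cases hi' : i = Fin.last n <;> by_cases hj : j = 0 <;>
        by_cases hj' : j = Fin.last n <;> simp_all
    · simp only [Matrix.trace, Matrix.diag_apply, Matrix.of_apply, eLast, eZero, Pi.single_apply]
      refine Finset.sum_eq_zero fun i _ => ?_
      by_cases hi : i = 0 <;> by_cases hi' : i = Fin.last n <;> simp_all⟩, by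
    have hz := @zero_ne_last n _
    change ⁅a₁ n, _⁆ = _
    ext i j
    rw [LieSubalgebra.coe_bracket, LieRing.of_associative_ring_bracket, a₁_commutator_apply]
    simp only [Matrix.of_apply, eLast, eZero, Pi.single_apply]
    by_cases hi : i = 0 <;> by_cases hi' : i = Fin.last n <;> by_cases hj : j = 0 <;>
      by_cases hj' : j = Fin.last n <;> simp_all⟩

theorem ofCol_apply {n : ℕ} [NeZero n] (c : Fin (n + 1) → ℝ) (h0 : c 0 = 0)
    (hl : c (Fin.last n) = 0) (i : Fin (n + 1)) :
    ((ofCol c h0 hl : so n) : Mat n) i (Fin.last n) = c i := by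
  change c i * (eLast n (Fin.last n) - eZero n (Fin.last n))
    + (eZero n i + eLast n i) * c (Fin.last n) = c i
  rw [hl]
  simp [eLast, eZero, NeZero.ne n]

/-- The image of the time-like basis vector under `exp X · exp (t a₁)`. -/
theorem expG_mul_expG_mulVec {n : ℕ} [NeZero n] (X : nSub n) (t : ℝ) :
    mat (expG (X : so n) * expG (t • a₁ n)) *ᵥ eLast n
      = (Real.exp t / 2) • (eZero n + eLast n) - (Real.exp (-t) / 2) • (eZero n - eLast n)
        + Real.exp (-t) • (fun i => ((X : so n) : Mat n) i (Fin.last n))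
        + (Real.exp (-t) / 2 * ∑ j, ((X : so n) : Mat n) j (Fin.last n) ^ 2)
          • (eZero n + eLast n) := by
  rw [mat_mul, ← Matrix.mulVec_mulVec, expG_a₁_mulVec]
  set u := (Real.exp t / 2) • (eZero n + eLast n) - (Real.exp (-t) / 2) • (eZero n - eLast n)
    with hu
  have h1 : ((X : so n) : Mat n) *ᵥ u
      = Real.exp (-t) • (((X : so n) : Mat n) *ᵥ eLast n) := by
    -- `X` sees `u` only modulo the null vector, that is, as `e^{-t} e_last`.
    have : u = (Real.exp t / 2 - Real.exp (-t) / 2) • (eZero n + eLast n)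
        + Real.exp (-t) • eLast n := by
      rw [hu]
      module
    rw [this, Matrix.mulVec_add, Matrix.mulVec_smul, Matrix.mulVec_smul, nSub_mulVec_add,
      smul_zero, zero_add]
  rw [mat_expG, exp_mulVec_of_cube, h1, Matrix.mulVec_smul, nSub_mulVec_eLast, mulVec_eLast]
  · module
  · rw [h1, Matrix.mulVec_smul, nSub_mulVec_eLast, Matrix.mulVec_smul, Matrix.mulVec_smul,
      nSub_mulVec_add, smul_zero, smul_zero]

theorem expG_mul_expG_mulVec_injective {n : ℕ} [NeZero n] {X Y : nSub n} {s t : ℝ}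
    (h : mat (expG (X : so n) * expG (s • a₁ n)) *ᵥ eLast n
      = mat (expG (Y : so n) * expG (t • a₁ n)) *ᵥ eLast n) : X = Y ∧ s = t := by
  rw [expG_mul_expG_mulVec, expG_mul_expG_mulVec] at h
  have h0 := congrFun h 0
  have hl := congrFun h (Fin.last n)
  have z := @zero_ne_last n _
  simp only [Pi.add_apply, Pi.sub_apply, Pi.smul_apply, smul_eq_mul, nSub_zero_last, so_diag]
    at h0 hl
  have e1 : eZero n 0 = 1 := by simp [eZero]
  have e2 : eLast n 0 = 0 := by simp [eLast, z]
  have e3 : eZero n (Fin.last n) = 0 := by simp [eZero, NeZero.ne n]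
  have e4 : eLast n (Fin.last n) = 1 := by simp [eLast]
  rw [e1, e2] at h0
  rw [e3, e4] at hl
  -- The last coordinate minus the coordinate `0` is `e^{-t}`; the middle coordinates are then
  -- `e^{-t}` times the last column of `X`.
  have hst : s = t := by
    have : Real.exp (-s) = Real.exp (-t) := by linarith
    exact neg_injective (Real.exp_injective this)
  subst hst
  refine ⟨nSub_ext fun i hi hi' => ?_, rfl⟩
  have hi := congrFun h i
  have e5 : eZero n i = 0 := by simp [eZero, *]
  have e6 : eLast n i = 0 := by simp [eLast, *]
  simp only [Pi.add_apply, Pi.sub_apply, Pi.smul_apply, smul_eq_mul, e5, e6] at hi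
  refine mul_left_cancel₀ (Real.exp_pos (-s)).ne' ?_
  linarith

theorem sum_eq_add_add_sum {n : ℕ} [NeZero n] (f : Fin (n + 1) → ℝ) :
    ∑ i, f i = f 0 + f (Fin.last n) + ∑ i, if i = 0 ∨ i = Fin.last n then 0 else f i := by
  have h : ∀ i, f i = (if i = 0 then f i else 0) + (if i = Fin.last n then f i else 0)
      + (if i = 0 ∨ i = Fin.last n then 0 else f i) := by
    intro i
    have z := @zero_ne_last n _
    by_cases hi : i = 0 <;> by_cases hi' : i = Fin.last n <;> simp_all
  rw [Finset.sum_congr rfl fun i _ => h i, Finset.sum_add_distrib, Finset.sum_add_distrib]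
  simp

/-- `𝔫 × 𝔞` parametrizes the upper sheet of the hyperboloid. -/
theorem exists_expG_mul_expG_mulVec {n : ℕ} [NeZero n] {w : Fin (n + 1) → ℝ}
    (hw : ∑ i, w i ^ 2 = 2 * w (Fin.last n) ^ 2 - 1) (hpos : 0 < w (Fin.last n)) :
    ∃ (X : nSub n) (t : ℝ), mat (expG (X : so n) * expG (t • a₁ n)) *ᵥ eLast n = w := by
  have z := @zero_ne_last n _
  set r := ∑ i, if i = 0 ∨ i = Fin.last n then 0 else w i ^ 2 with hr
  rw [sum_eq_add_add_sum, ← hr] at hw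
  have hr0 : 0 ≤ r := Finset.sum_nonneg fun i _ => by split_ifs <;> positivity
  set s := w (Fin.last n) - w 0 with hs
  -- The hyperboloid equation reads `w_last² - w₀² = r + 1`, and `w_last > 0`.
  have hs0 : 0 < s := by nlinarith
  -- The witnesses are forced by `s = e^{-t}` and by the middle coordinates.
  refine ⟨ofCol (fun i => if i = 0 ∨ i = Fin.last n then 0 else w i / s) (by simp) (by simp),
    -Real.log s, ?_⟩
  rw [expG_mul_expG_mulVec]
  simp only [ofCol_apply, neg_neg, Real.exp_neg, Real.exp_log hs0]
  have hsum : ∑ i, (if i = 0 ∨ i = Fin.last n then 0 else w i / s) ^ 2 = r / s ^ 2 := by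
    rw [hr, Finset.sum_div]
    refine Finset.sum_congr rfl fun i _ => ?_
    split_ifs
    · simp
    · rw [div_pow]
  rw [hsum]
  have e1 : eZero n 0 = 1 := by simp [eZero]
  have e2 : eLast n 0 = 0 := by simp [eLast, z]
  have e3 : eZero n (Fin.last n) = 0 := by simp [eZero, NeZero.ne n]
  have e4 : eLast n (Fin.last n) = 1 := by simp [eLast]
  ext i
  simp only [Pi.add_apply, Pi.sub_apply, Pi.smul_apply, smul_eq_mul]
  by_cases hi : i = 0
  · subst hi
    rw [e1, e2, if_pos (Or.inl rfl)]
    field_simp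
    rw [hs]
    linear_combination hw
  by_cases hi' : i = Fin.last n
  · subst hi'
    rw [e3, e4, if_pos (Or.inr rfl)]
    field_simp
    rw [hs]
    linear_combination hw
  · have e5 : eZero n i = 0 := by simp [eZero, hi]
    have e6 : eLast n i = 0 := by simp [eLast, hi']
    rw [e5, e6, if_neg (by simp [hi, hi'])]
    field_simp
    ring

/-! ### The identity component and the stabilizer of the time-like basis vector -/

/-- The last column has Lorentz norm `-1`, written here with the Euclidean sum of squares. -/
theorem sum_sq_last_col {n : ℕ} {A : Mat n} (hA : Aᵀ * J n * A = J n) :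
    ∑ i, A i (Fin.last n) ^ 2 = 2 * A (Fin.last n) (Fin.last n) ^ 2 - 1 := by
  have h := congrFun (congrFun hA (Fin.last n)) (Fin.last n)
  rw [Matrix.mul_apply] at h
  simp only [J, Matrix.mul_diagonal, Matrix.transpose_apply, Matrix.diagonal_apply_eq,
    if_true] at h
  have h2 : ∀ i, A i (Fin.last n) * (if i = Fin.last n then -1 else 1) * A i (Fin.last n)
      = A i (Fin.last n) ^ 2 - if i = Fin.last n then 2 * A i (Fin.last n) ^ 2 else 0 := by
    intro i
    split_ifs <;> ring
  rw [Finset.sum_congr rfl fun i _ => h2 i, Finset.sum_sub_distrib] at h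
  simp only [Finset.sum_ite_eq', Finset.mem_univ, if_true] at h
  linarith

/-- This entry cannot vanish on the full group, where a sum of squares would be `-1`; on the
identity component it keeps the sign it has at `1`. This is where connectedness of `G` enters. -/
theorem last_last_pos {n : ℕ} (g : G n) : 0 < mat g (Fin.last n) (Fin.last n) := by
  obtain ⟨h, hh, hg⟩ := g.2
  let φ : fullGroup n → ℝ := fun A => ((A : GL (Fin (n + 1)) ℝ) : Mat n) (Fin.last n) (Fin.last n)
  have hφ : Continuous φ :=
    (Units.continuous_val.comp continuous_subtype_val).matrix_elem _ _
  have hne : ∀ A, φ A ≠ 0 := by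
    intro A h0
    have h1 := sum_sq_last_col A.2.1
    have h2 : (0 : ℝ) ≤ ∑ i, ((A : GL (Fin (n + 1)) ℝ) : Mat n) i (Fin.last n) ^ 2 :=
      Finset.sum_nonneg fun i _ => sq_nonneg _
    rw [h1, show ((A : GL (Fin (n + 1)) ℝ) : Mat n) (Fin.last n) (Fin.last n) = 0 from h0] at h2
    norm_num at h2
  have hconn : IsPreconnected (φ '' connectedComponent (1 : fullGroup n)) :=
    isPreconnected_connectedComponent.image φ hφ.continuousOn
  have h1 : (1 : ℝ) ∈ φ '' connectedComponent (1 : fullGroup n) :=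
    ⟨1, mem_connectedComponent, by simp [φ]⟩
  have hmem : φ h ∈ φ '' connectedComponent (1 : fullGroup n) := ⟨h, hh, rfl⟩
  have hpos : 0 < φ h := by
    by_contra hle
    obtain ⟨A, -, hA⟩ := hconn.Icc_subset hmem h1 ⟨not_lt.1 hle, zero_le_one⟩
    exact hne A hA
  change 0 < ((g : GL (Fin (n + 1)) ℝ) : Mat n) _ _
  rw [← hg]
  exact hpos

theorem J_mulVec_eLast {n : ℕ} : J n *ᵥ eLast n = -eLast n := by
  rw [mulVec_eLast]
  ext i
  by_cases hi : i = Fin.last n <;> simp [J, eLast, hi]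

theorem J_eq {n : ℕ} : J n = 1 - (2 : ℝ) • Matrix.vecMulVec (eLast n) (eLast n) := by
  ext i j
  by_cases hi : i = Fin.last n <;> by_cases hij : i = j <;>
    simp_all [J, eLast, Matrix.vecMulVec_apply, Pi.single_apply]
  norm_num

/-- An orthogonal `k` commutes with `J`, so its last column is `±e_last`, and positivity selects the
sign. Conversely both `k` and `kᵀ` fix `e_last`, so the rank-one part of `J` cancels in `kᵀJk = J`
and leaves `kᵀk = 1`. -/
theorem mem_KGroup_iff {n : ℕ} {k : G n} : k ∈ KGroup n ↔ mat k *ᵥ eLast n = eLast n := by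
  constructor
  · intro hk
    have h1 : J n * mat k = mat k * J n := by
      have h := mat_transpose_mul_J k⁻¹
      rw [inv_inv, mat_inv_of_mem_KGroup hk, Matrix.transpose_transpose] at h
      exact h.symm
    have hcol : ∀ i, i ≠ Fin.last n → mat k i (Fin.last n) = 0 := by
      intro i hi
      have h := congrFun (congrFun h1 i) (Fin.last n)
      simp only [J, Matrix.mul_diagonal, Matrix.diagonal_mul, hi, if_true, if_false] at h
      linarith
    have hsq := sum_sq_last_col (mat_transpose_mul_J_mul k)
    rw [Finset.sum_eq_single (Fin.last n) (fun i _ hi => by rw [hcol i hi]; simp) (by simp)] at hsq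
    have hone : mat k (Fin.last n) (Fin.last n) = 1 := by
      have := last_last_pos k
      nlinarith
    rw [mulVec_eLast]
    ext i
    by_cases hi : i = Fin.last n
    · simp [hi, hone, eLast]
    · simp [hcol i hi, eLast, hi]
  · intro hk
    have h1 : (mat k)ᵀ *ᵥ eLast n = eLast n := by
      have h := congrArg (· *ᵥ eLast n) (mat_transpose_mul_J_mul k)
      simp only [← Matrix.mulVec_mulVec, hk, J_mulVec_eLast, Matrix.mulVec_neg] at h
      exact neg_injective h
    have h2 : eLast n ᵥ* mat k = eLast n := by rw [← Matrix.mulVec_transpose, h1]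
    have h := mat_transpose_mul_J_mul k
    rw [J_eq, Matrix.mul_sub, Matrix.sub_mul, Matrix.mul_one, Matrix.mul_smul, Matrix.smul_mul,
      Matrix.mul_vecMulVec, Matrix.vecMulVec_mul, h1, h2] at h
    exact sub_left_injective h

/-- Every element of `G` has a unique Iwasawa decomposition. -/
theorem existsUnique_isIwasawa {n : ℕ} [NeZero n] (g : G n) :
    ∃! q : G n × ℝ × G n, IsIwasawa g q.1 q.2.1 q.2.2 := by
  have hneg : ∀ X : so n, expG (-X) = (expG X)⁻¹ := fun X => by
    rw [eq_inv_iff_mul_eq_one, ← expG_add (by simp), neg_add_cancel, expG_zero]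
  -- Inverting `g` puts the `K`-factor on the right, where it fixes `e_last`; only the `N` and `A`
  -- factors remain visible.
  have key : ∀ (k ν : G n) (X : nSub n) (t : ℝ), k ∈ KGroup n → ν = expG (X : so n) →
      g = k * expG (t • a₁ n) * ν →
      mat (expG ((-X : nSub n) : so n) * expG ((-t) • a₁ n)) *ᵥ eLast n = mat g⁻¹ *ᵥ eLast n := by
    intro k ν X t hk hν hg
    rw [hg, mul_inv_rev, mul_inv_rev, ← mul_assoc, mat_mul _ k⁻¹, ← Matrix.mulVec_mulVec,
      mem_KGroup_iff.1 (inv_mem_KGroup hk), hν, Submodule.coe_neg, hneg, neg_smul, hneg]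
  obtain ⟨X, t, hX⟩ := exists_expG_mul_expG_mulVec (w := mat g⁻¹ *ᵥ eLast n)
    (by simpa only [mulVec_eLast] using sum_sq_last_col (mat_transpose_mul_J_mul g⁻¹))
    (by simpa only [mulVec_eLast] using last_last_pos g⁻¹)
  have hk : g * (expG (X : so n) * expG (t • a₁ n)) ∈ KGroup n := by
    rw [mem_KGroup_iff, mat_mul, ← Matrix.mulVec_mulVec, hX, Matrix.mulVec_mulVec, mat_mul_inv,
      Matrix.one_mulVec]
  have hex : IsIwasawa g (g * (expG (X : so n) * expG (t • a₁ n))) (-t) (expG (-X : so n)) := by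
    refine ⟨hk, ⟨_, (-X).2, rfl⟩, ?_⟩
    rw [neg_smul, hneg, hneg]
    group
  refine ⟨(_, _, _), hex, ?_⟩
  rintro ⟨k, s, ν⟩ ⟨hk', ⟨Y, hY, hν⟩, hg⟩
  have h1 := key k ν ⟨Y, hY⟩ s hk' hν hg
  have h2 := key _ _ (-X) (-t) hex.1 rfl hex.2.2
  obtain ⟨h3, h4⟩ := expG_mul_expG_mulVec_injective (h1.trans h2.symm)
  have hs : s = -t := neg_injective h4
  have hY' : Y = -(X : so n) := congrArg Subtype.val (neg_injective h3)
  have hν' : ν = expG (-(X : so n)) := by rw [← hY']; exact hν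
  have hk'' : k = g * (expG (X : so n) * expG (t • a₁ n)) := by
    have hg' : g = k * expG (s • a₁ n) * ν := hg
    rw [hg', hν', hs, neg_smul, hneg, hneg]
    group
  exact Prod.ext hk'' (Prod.ext hs hν')

theorem IsIwasawa.iwasawa_eq {n : ℕ} [NeZero n] {g k ν : G n} {t : ℝ} (h : IsIwasawa g k t ν) :
    iwasawa g = (k, t, ν) := by
  have hex : ∃ q : G n × ℝ × G n, IsIwasawa g q.1 q.2.1 q.2.2 := ⟨(k, t, ν), h⟩
  rw [iwasawa, dif_pos hex]
  exact (existsUnique_isIwasawa g).unique hex.choose_spec h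

/-! ### The operators in Iwasawa coordinates -/

theorem expG_add_smul {n : ℕ} (s t : ℝ) (X : so n) :
    expG ((s + t) • X) = expG (s • X) * expG (t • X) := by
  rw [add_smul, expG_add]
  rw [lie_smul, smul_lie, lie_self, smul_zero, smul_zero]

theorem expG_smul_comm {n : ℕ} (s t : ℝ) (X : so n) :
    expG (s • X) * expG (t • X) = expG (t • X) * expG (s • X) := by
  rw [← expG_add_smul, add_comm s, expG_add_smul]

theorem expG_mul_eq {n : ℕ} (X : so n) (k : G n) : expG X * k = k * expG (Ad k⁻¹ X) := by
  have h := mul_expG_eq_expG_Ad_mul k⁻¹ X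
  rw [inv_mul_eq_iff_eq_mul, ← mul_assoc, eq_mul_inv_iff_mul_eq] at h
  exact h

theorem IsIwasawa.mul_exp_a₁ {n : ℕ} [NeZero n] {g k ν : G n} {t : ℝ} (h : IsIwasawa g k t ν)
    (s : ℝ) : IsIwasawa (k * expG (s • a₁ n) * expG (t • a₁ n) * ν) k (s + t) ν :=
  ⟨h.1, h.2.1, by rw [expG_add_smul, mul_assoc k]⟩

theorem IsIwasawa.mul_exp_k {n : ℕ} [NeZero n] {g k ν : G n} {t : ℝ} (h : IsIwasawa g k t ν)
    (x : kAlg n) :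
    IsIwasawa (k * expG (x : so n) * expG (t • a₁ n) * ν) (k * expG (x : so n)) t ν :=
  ⟨mul_mem_KGroup h.1 (expG_mem_KGroup x), h.2.1, rfl⟩

/-- Like the two preceding lemmas, this gives the coordinates of a displaced point, needed to
iterate the operators. Here `N` is closed under products because `𝔫` is abelian. -/
theorem IsIwasawa.mul_exp_n {n : ℕ} [NeZero n] {g k ν : G n} {t : ℝ} (h : IsIwasawa g k t ν)
    (x : nSub n) :
    IsIwasawa (k * expG (t • a₁ n) * expG (x : so n) * ν) k t (expG (x : so n) * ν) := by
  obtain ⟨X, hX, hν⟩ := h.2.1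
  refine ⟨h.1, ⟨(x : so n) + X, add_mem x.2 hX, ?_⟩, by rw [mul_assoc _ _ ν]⟩
  rw [hν, expG_add (lie_eq_zero_of_mem_nSub x.2 hX)]

theorem opA_eq {n : ℕ} [NeZero n] {g k ν : G n} {t : ℝ} (h : IsIwasawa g k t ν)
    (f : G n → ℂ) :
    opA f g = deriv (fun s : ℝ => f (k * expG (s • a₁ n) * expG (t • a₁ n) * ν)) 0 := by
  simp only [opA, h.iwasawa_eq]

theorem opK_eq {n : ℕ} [NeZero n] {g k ν : G n} {t : ℝ} (h : IsIwasawa g k t ν)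
    (x : kAlg n) (f : G n → ℂ) :
    opK x f g = deriv (fun s : ℝ => f (k * expG (s • (x : so n)) * expG (t • a₁ n) * ν)) 0 := by
  simp only [opK, h.iwasawa_eq]

theorem opN_eq {n : ℕ} [NeZero n] {g k ν : G n} {t : ℝ} (h : IsIwasawa g k t ν)
    (x : nSub n) (f : G n → ℂ) :
    opN x f g = deriv (fun s : ℝ => f (k * expG (t • a₁ n) * expG (s • (x : so n)) * ν)) 0 := by
  simp only [opN, h.iwasawa_eq]

theorem rightDeriv_rightTranslate {n : ℕ} (X : so n) (h : G n) (f : SmoothFun n) (k : G n) :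
    (rightDeriv X (rightTranslate h f) : G n → ℂ) k
      = deriv (fun s : ℝ => (f : G n → ℂ) (k * expG (s • X) * h)) 0 := rfl

theorem rightDeriv_apply {n : ℕ} (X : so n) (f : SmoothFun n) (k : G n) :
    (rightDeriv X f : G n → ℂ) k = deriv (fun s : ℝ => (f : G n → ℂ) (k * expG (s • X))) 0 := rfl

theorem leftDeriv_apply {n : ℕ} (X : so n) (f : SmoothFun n) (k : G n) :
    (leftDeriv X f : G n → ℂ) k = deriv (fun s : ℝ => (f : G n → ℂ) (expG (s • X) * k)) 0 := rfl

theorem opA_eq_rightDeriv {n : ℕ} [NeZero n] {g k ν : G n} {t : ℝ} (h : IsIwasawa g k t ν)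
    (f : SmoothFun n) :
    opA f g = (rightDeriv (a₁ n) (rightTranslate (expG (t • a₁ n) * ν) f) : G n → ℂ) k := by
  rw [opA_eq h, rightDeriv_rightTranslate]
  simp only [mul_assoc]

theorem opA_opA {n : ℕ} [NeZero n] {g k ν : G n} {t : ℝ} (h : IsIwasawa g k t ν)
    (f : SmoothFun n) :
    opA (opA f) g = (rightDeriv (a₁ n)
      (rightDeriv (a₁ n) (rightTranslate (expG (t • a₁ n) * ν) f)) : G n → ℂ) k := by
  rw [opA_eq h, rightDeriv_apply]
  congr 1
  funext s
  rw [opA_eq_rightDeriv (h.mul_exp_a₁ s), rightDeriv_rightTranslate, rightDeriv_rightTranslate]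
  congr 1
  funext r
  rw [expG_add_smul, mul_assoc k (expG (s • a₁ n)), expG_smul_comm s r]
  simp only [mul_assoc]

/-- Moving `exp(sx)` to the left of `a = exp(t a₁)` rescales `x` by `e^t`. -/
theorem opN_eq_rightDeriv {n : ℕ} [NeZero n] {g k ν : G n} {t : ℝ} (h : IsIwasawa g k t ν)
    (x : nSub n) (f : SmoothFun n) :
    opN x f g = (rightDeriv (Real.exp t • (x : so n))
      (rightTranslate (expG (t • a₁ n) * ν) f) : G n → ℂ) k := by
  rw [opN_eq h, rightDeriv_rightTranslate]
  congr 1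
  funext s
  have := expG_a₁_mul_expG t (s • x)
  rw [Submodule.coe_smul, smul_comm] at this
  rw [mul_assoc k, this]
  simp only [mul_assoc]

/-- Displacing `k` changes neither `t` nor `ν`, so the inner operator is the same right derivative
all along the curve. -/
theorem opK_opN {n : ℕ} [NeZero n] {g k ν : G n} {t : ℝ} (h : IsIwasawa g k t ν)
    (y : kAlg n) (x : nSub n) (f : SmoothFun n) :
    opK y (opN x f) g = (rightDeriv (y : so n) (rightDeriv (Real.exp t • (x : so n))
      (rightTranslate (expG (t • a₁ n) * ν) f)) : G n → ℂ) k := by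
  rw [opK_eq h, rightDeriv_apply]
  congr 1
  funext s
  exact opN_eq_rightDeriv (h.mul_exp_k (s • y)) x f

theorem opN_opN {n : ℕ} [NeZero n] {g k ν : G n} {t : ℝ} (h : IsIwasawa g k t ν)
    (x : nSub n) (f : SmoothFun n) :
    opN x (opN x f) g = (rightDeriv (Real.exp t • (x : so n)) (rightDeriv (Real.exp t • (x : so n))
      (rightTranslate (expG (t • a₁ n) * ν) f)) : G n → ℂ) k := by
  rw [opN_eq h, rightDeriv_apply]
  congr 1
  funext s
  refine (opN_eq_rightDeriv (h.mul_exp_n (s • x)) x f).trans ?_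
  rw [rightDeriv_rightTranslate, rightDeriv_rightTranslate]
  congr 1
  funext r
  have := expG_a₁_mul_expG t (s • x)
  rw [Submodule.coe_smul, smul_comm] at this
  rw [← mul_assoc (expG (t • a₁ n)), Submodule.coe_smul, this, mul_assoc k (expG (s • _)),
    expG_smul_comm s r]
  simp only [mul_assoc]

/-- Left derivatives compose in the opposite order to right ones; this is harmless here because both
are along the same `X`. -/
theorem leftDeriv_leftDeriv {n : ℕ} (X : so n) (f : SmoothFun n) (k h : G n) :
    (leftDeriv X (leftDeriv X f) : G n → ℂ) (k * h)
      = (rightDeriv (Ad k⁻¹ X) (rightDeriv (Ad k⁻¹ X) (rightTranslate h f)) : G n → ℂ) k := by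
  rw [leftDeriv_apply, rightDeriv_apply]
  congr 1
  funext s
  rw [leftDeriv_apply, rightDeriv_rightTranslate]
  congr 1
  funext r
  rw [← map_smul (Ad k⁻¹) s, ← map_smul (Ad k⁻¹) r, ← expG_mul_eq, mul_assoc _ k, ← expG_mul_eq,
    ← mul_assoc (expG (s • X)), ← mul_assoc (expG (r • X)), ← mul_assoc (expG (r • X)),
    ← mul_assoc (expG (s • X)), expG_smul_comm]

/-! ### Casimir elements as sums of second derivatives -/

theorem leftOp_casimir {n : ℕ} {ι κ : Type*} [Fintype ι] [Fintype κ] (K : ι → so n)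
    (P : κ → so n) (f : SmoothFun n) (g : G n) :
    (leftOp (casimir K P) f : G n → ℂ) g
      = -∑ i, (leftDeriv (K i) (leftDeriv (K i) f) : G n → ℂ) g
        + ∑ j, (leftDeriv (P j) (leftDeriv (P j) f) : G n → ℂ) g := by
  have h : ∀ y : so n, leftDerivHom n y = MulOpposite.op (leftDeriv y) := fun _ => rfl
  simp only [leftOp, casimir, map_add, map_neg, map_sum, map_mul,
    UniversalEnvelopingAlgebra.lift_ι_apply, h, MulOpposite.unop_add, MulOpposite.unop_neg,
    MulOpposite.unop_mul, MulOpposite.unop_op, Finset.unop_sum, LinearMap.add_apply,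
    LinearMap.neg_apply, LinearMap.sum_apply, pow_two, Module.End.mul_apply, Submodule.coe_add,
    Submodule.coe_neg, Submodule.coe_sum, Pi.add_apply, Pi.neg_apply, Finset.sum_apply]

theorem rightOp_casimirM {n : ℕ} [NeZero n] {μ : Type*} [Fintype μ] (b : μ → mAlg n)
    (f : SmoothFun n) (g : G n) :
    (rightOp (fromM n (casimirM b)) f : G n → ℂ) g
      = -∑ j, (rightDeriv (b j : so n) (rightDeriv (b j : so n) f) : G n → ℂ) g := by
  have h : ∀ y : so n, rightDerivHom n y = rightDeriv y := fun _ => rfl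
  have h' : ∀ y : mAlg n, ((UniversalEnvelopingAlgebra.ι ℝ : so n →ₗ⁅ℝ⁆ _).comp (mAlg n).incl) y
    = UniversalEnvelopingAlgebra.ι ℝ (y : so n) := fun _ => rfl
  simp only [rightOp, fromM, casimirM, map_neg, map_sum, map_mul,
    UniversalEnvelopingAlgebra.lift_ι_apply, h, h', LinearMap.neg_apply, LinearMap.sum_apply,
    pow_two, Module.End.mul_apply, Submodule.coe_neg, Submodule.coe_sum, Pi.neg_apply,
    Finset.sum_apply]

/-- `X ↦ ℜ_X F (k)`. -/
noncomputable def derivAt {n : ℕ} (F : SmoothFun n) (k : G n) : so n →ₗ[ℝ] ℂ where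
  toFun X := (rightDeriv X F : G n → ℂ) k
  map_add' X Y := congrArg (fun T : Module.End ℝ (SmoothFun n) => (T F : G n → ℂ) k)
    ((rightDerivHom n).map_add X Y)
  map_smul' c X := congrArg (fun T : Module.End ℝ (SmoothFun n) => (T F : G n → ℂ) k)
    ((rightDerivHom n).map_smul c X)

/-- `(X, Y) ↦ ℜ_X ℜ_Y F (k)`. -/
noncomputable def derivAt₂ {n : ℕ} (F : SmoothFun n) (k : G n) : so n →ₗ[ℝ] so n →ₗ[ℝ] ℂ :=
  LinearMap.mk₂ ℝ (fun X Y => (rightDeriv X (rightDeriv Y F) : G n → ℂ) k)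
    (fun X Y Z => (derivAt (rightDeriv Z F) k).map_add X Y)
    (fun c X Z => (derivAt (rightDeriv Z F) k).map_smul c X)
    (fun X Y Z => congrArg
      (fun T : Module.End ℝ (SmoothFun n) => (rightDeriv X (T F) : G n → ℂ) k)
        ((rightDerivHom n).map_add Y Z) |>.trans
      (congrArg (fun φ : SmoothFun n => (φ : G n → ℂ) k) ((rightDeriv X).map_add _ _)))
    (fun c X Z => congrArg
      (fun T : Module.End ℝ (SmoothFun n) => (rightDeriv X (T F) : G n → ℂ) k)
        ((rightDerivHom n).map_smul c Z) |>.trans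
      (congrArg (fun φ : SmoothFun n => (φ : G n → ℂ) k) ((rightDeriv X).map_smul c _)))

/-- Right derivation is a Lie algebra morphism; this is the condition `hQ` of `casimir_sum_eq`. -/
theorem derivAt₂_sub {n : ℕ} (F : SmoothFun n) (k : G n) (X Y : so n) :
    derivAt₂ F k X Y - derivAt₂ F k Y X = derivAt F k ⁅X, Y⁆ :=
  (congrArg (fun T : Module.End ℝ (SmoothFun n) => (T F : G n → ℂ) k)
    ((rightDerivHom n).map_lie X Y)).symm

end LorentzCasimir

open LorentzCasimir
theorem mainTheorem5 (n : ℕ) [NeZero n] (hn : 2 ≤ n)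
    {ι κ μ : Type*} [Fintype ι] [Fintype κ] [Fintype μ]
    (bk : Module.Basis ι ℝ (kAlg n)) (hbk : IsOrthonormal fun i => (bk i : so n))
    (bp : Module.Basis κ ℝ (pSub n)) (hbp : IsOrthonormal fun j => (bp j : so n))
    (bm : Module.Basis μ ℝ (mAlg n)) (hbm : IsOrthonormal fun j => (bm j : so n))
    (bn : Module.Basis (Fin (n - 1)) ℝ (nSub n)) (hbn : IsOrthonormal fun i => (bn i : so n)) :
    (∀ g : G n, ∃! q : G n × ℝ × G n, IsIwasawa g q.1 q.2.1 q.2.2) ∧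
    ∀ (f : SmoothFun n) (g k : G n) (t : ℝ) (ν : G n), IsIwasawa g k t ν →
      (leftOp (casimir (fun i => (bk i : so n)) (fun j => (bp j : so n))) f : G n → ℂ) g =
        opA (opA f) g + ((n : ℂ) - 1) * opA f g
          + 2 * Real.exp (-t) * ∑ i : Fin (n - 1),
              (-(Real.sqrt 2 : ℂ) * opK (kVec (bn i)) (opN (bn i) f) g
                + Real.exp (-t) * opN (bn i) (opN (bn i) f) g)
          + opKEnv (fromM n (casimirM bm)) f g := by
  refine ⟨existsUnique_isIwasawa, fun f g k t ν h => ?_⟩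
  set F := rightTranslate (expG (t • a₁ n) * ν) f with hF
  have hQ : ∀ X Y, (rightDeriv X (rightDeriv Y F) : G n → ℂ) k = derivAt₂ F k X Y :=
    fun _ _ => rfl
  have hleft : ∀ y : so n, (leftDeriv y (leftDeriv y f) : G n → ℂ) g
      = derivAt₂ F k (Ad k⁻¹ y) (Ad k⁻¹ y) := by
    intro y
    rw [h.2.2, mul_assoc, leftDeriv_leftDeriv]
    rfl
  have hm : opKEnv (fromM n (casimirM bm)) f g
      = -∑ j, derivAt₂ F k (bm j : so n) (bm j : so n) := by
    simp only [opKEnv, h.iwasawa_eq, rightOp_casimirM]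
    rfl
  have hexp : (Real.exp (-t) : ℂ) * Real.exp t = 1 := by
    rw [← Complex.ofReal_mul, ← Real.exp_add, neg_add_cancel, Real.exp_zero, Complex.ofReal_one]
  have hterm : ∀ i, 2 * (Real.exp (-t) : ℂ) *
      (-(Real.sqrt 2 : ℂ) * opK (kVec (bn i)) (opN (bn i) f) g
      + Real.exp (-t) * opN (bn i) (opN (bn i) f) g)
      = (2 : ℝ) • derivAt₂ F k (bn i) (bn i)
        - (2 * Real.sqrt 2) • derivAt₂ F k (kVec (bn i) : so n) (bn i) := by
    intro i
    rw [opK_opN h, opN_opN h, ← hF, hQ, hQ]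
    simp only [map_smul, LinearMap.smul_apply, Complex.real_smul, Complex.ofReal_mul,
      Complex.ofReal_ofNat]
    -- With `x = e^{-t}e^t`, the mixed term needs `x - 1 = 0` and the term quadratic in `𝔑` needs
    -- `x² - 1 = (x + 1)(x - 1) = 0`.
    linear_combination (-2 * (Real.sqrt 2 : ℂ) * derivAt₂ F k (kVec (bn i) : so n) (bn i)
      + 2 * derivAt₂ F k (bn i) (bn i) * ((Real.exp (-t) : ℂ) * Real.exp t + 1)) * hexp
  rw [leftOp_casimir, Finset.mul_sum, Finset.sum_congr rfl fun i _ => hterm i, hm, opA_opA h,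
    opA_eq_rightDeriv h]
  simp only [hleft]
  rw [casimir_sum_eq hn bk hbk bp hbp bm hbm bn hbn (Ad k⁻¹) (Ad_theta (inv_mem_KGroup h.1))
    (derivAt₂ F k) (derivAt F k) (derivAt₂_sub F k), Complex.real_smul, sub_eq_add_neg]
  push_cast
  rfl
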